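/- Let $M\subset\mathbb C^3$ be the set of all $(z,w_1,w_2)$ with $$\operatorname{Im} w_1=z^4\bar z^{10}+z^{10}\bar z^4+(\operatorname{Re} w_1)|z|^8+(\operatorname{Re} w_2)|z|^4,\qquad \operatorname{Im} w_2=0 .$$ Then $M$ is a real analytic CR submanifold of $\mathbb C^3$ of real codimension $2$ and CR dimension $1$, and the following hold. (a) $M$ is holomorphically nondegenerate: for no $p\in M$ is there a germ at $p$ of a holomorphic vector field $\sum_j c_j(Z)\,\partial/\partial Z_j$ on $\mathbb C^3$ that is tangent to $M$ and does not vanish identically on $M$ near $p$. (b) $M$ is nowhere minimal: through every $p\in M$ there is a CR submanifold $N\subset M$ with $\dim_{\mathbb R} N<\dim_{\mathbb R} M$ that has the same CR dimension as $M$. (c) $\operatorname{hol}(M,0)=\{0\}$. Here an infinitesimal holomorphism of $M$ at $p$ is a smooth real vector field $X$ on a neighbourhood of $p$ in $M$ whose local one-parameter group $\exp tX$ extends, near $p$ and for small $t$, to a local one-parameter group of biholomorphisms of $\mathbb C^3$, and $\operatorname{hol}(M,p)$ is the Lie algebra of germs at $p$ of vector fields on $M$ that is generated by the infinitesimal holomorphisms.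 -/

import Mathlib

open Set Filter
open scoped Topology ContDiff ComplexConjugate

noncomputable section

/-! Throughout, `E` is a complex normed space, in the application `ℂ³`; as a real space it carries
the scalar multiplication restricted from `ℂ`. A real vector field on a submanifold `M` of `E` is
written as a map `X : E → E`, of which only the values on `M` matter. -/

section General

variable {E : Type*} [NormedAddCommGroup E] [NormedSpace ℂ E]

/-- The (real) tangent space of `M` at `p`: the real span of the velocities at `p` of the smooth
curves that run in `M` and pass through `p`. (If `M` is an embedded submanifold, these velocities
already form a linear space.) -/
def realTangentSpace (M : Set E) (p : E) : Submodule ℝ E :=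
  Submodule.span ℝ {v | ∃ γ : ℝ → E, ContDiffAt ℝ ∞ γ 0 ∧ γ 0 = p ∧ (∀ᶠ t in 𝓝 0, γ t ∈ M) ∧
    HasDerivAt γ v 0}

/-- The complex tangent space `T_p M ∩ i T_p M`. -/
def complexTangentSpace (M : Set E) (p : E) : Submodule ℂ E where
  carrier := {v | v ∈ realTangentSpace M p ∧ Complex.I • v ∈ realTangentSpace M p}
  zero_mem' := by simp
  add_mem' := by
    rintro v w ⟨hv, hv'⟩ ⟨hw, hw'⟩
    refine ⟨add_mem hv hw, ?_⟩
    rw [smul_add]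
    exact add_mem hv' hw'
  smul_mem' := by
    rintro c v ⟨hv, hv'⟩
    have h1 : c • v = c.re • v + c.im • (Complex.I • v) := by
      conv_lhs => rw [← Complex.re_add_im c, add_smul, mul_smul]
      rfl
    have h2 : Complex.I • (c • v) = c.re • (Complex.I • v) + (-c.im) • v := by
      rw [h1, smul_add, smul_comm Complex.I c.re v, smul_comm Complex.I c.im (Complex.I • v),
        smul_smul Complex.I Complex.I v, Complex.I_mul_I, neg_one_smul, smul_neg, neg_smul]
    refine ⟨?_, ?_⟩
    · rw [h1]
      exact add_mem (Submodule.smul_mem _ _ hv) (Submodule.smul_mem _ _ hv')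
    · rw [h2]
      exact add_mem (Submodule.smul_mem _ _ hv') (Submodule.smul_mem _ _ hv)

/-- `M` is a real analytic submanifold of `E` of real codimension `d`: near each of its points it
is the common zero set of `d` real valued, real analytic functions with linearly independent
differentials. -/
def IsRealAnalyticSubmanifold (M : Set E) (d : ℕ) : Prop :=
  ∀ p ∈ M, ∃ U : Set E, IsOpen U ∧ p ∈ U ∧ ∃ ρ : Fin d → E → ℝ,
    (∀ j, AnalyticOnNhd ℝ (ρ j) U) ∧
    (∀ x ∈ U, LinearIndependent ℝ (fun j => fderiv ℝ (ρ j) x)) ∧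
    M ∩ U = {x ∈ U | ∀ j, ρ j x = 0}

/-- `M` is a real analytic CR submanifold of `E` of real codimension `d` and CR dimension `n`:
its complex tangent spaces all have complex dimension `n`. -/
structure IsCRSubmanifold (M : Set E) (d n : ℕ) : Prop where
  submanifold : IsRealAnalyticSubmanifold M d
  finrank_eq : ∀ p ∈ M, Module.finrank ℂ (complexTangentSpace M p) = n

/-- The CR submanifold `M` is minimal at `p`: there is no CR submanifold through `p`, contained in
`M` and of smaller dimension than `M`, that has the same CR dimension as `M`. -/
def IsMinimalAt (M : Set E) (p : E) : Prop :=
  ∀ d n : ℕ, IsCRSubmanifold M d n →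
    ¬ ∃ (N : Set E) (e : ℕ), N ⊆ M ∧ p ∈ N ∧ d < e ∧ IsCRSubmanifold N e n

/-- `M` is holomorphically nondegenerate: at no point `p ∈ M` is there a germ of a holomorphic
vector field `Y = ∑ c_j ∂/∂Z_j` that is tangent to `M` and does not vanish identically on `M`
near `p`. Tangency of `Y` to `M` means that the real vector fields `Re Y` and `Im Y` are tangent
to `M`, which is to say that the vectors `(c_j(q))_j`, `q ∈ M`, are complex tangent vectors. -/
def IsHolomorphicallyNondegenerate (M : Set E) : Prop :=
  ∀ p ∈ M, ∀ U : Set E, IsOpen U → p ∈ U → ∀ Y : E → E, DifferentiableOn ℂ Y U →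
    (∀ q ∈ M ∩ U, Y q ∈ complexTangentSpace M q) → ∀ᶠ q in 𝓝[M] p, Y q = 0

/-- `f` maps the open set `U` biholomorphically onto an open set. -/
def IsBiholomorphicOn (f : E → E) (U : Set E) : Prop :=
  DifferentiableOn ℂ f U ∧ IsOpen (f '' U) ∧
    ∃ g : E → E, DifferentiableOn ℂ g (f '' U) ∧ ∀ x ∈ U, g (f x) = x

/-- `Φ t`, for `|t| < ε`, is a local one-parameter group of biholomorphisms, defined on the open
set `U`. -/
structure IsLocalBiholomorphismGroup (Φ : ℝ → E → E) (U : Set E) (ε : ℝ) : Prop where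
  pos : 0 < ε
  isOpen : IsOpen U
  smooth : ContDiffOn ℝ ∞ (fun x : ℝ × E => Φ x.1 x.2) (Ioo (-ε) ε ×ˢ U)
  biholomorphic : ∀ t ∈ Ioo (-ε) ε, IsBiholomorphicOn (Φ t) U
  map_zero : ∀ x ∈ U, Φ 0 x = x
  map_add : ∀ s ∈ Ioo (-ε) ε, ∀ t ∈ Ioo (-ε) ε, s + t ∈ Ioo (-ε) ε →
    ∀ x ∈ U, Φ t x ∈ U → Φ (s + t) x = Φ s (Φ t x)

/-- `X` is (the extension to a neighbourhood `V` of `p` in `E` of) a smooth real vector field on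
`M ∩ V`. -/
def IsSmoothVectorFieldOn (M : Set E) (X : E → E) (V : Set E) : Prop :=
  ContDiffOn ℝ ∞ X V ∧ ∀ q ∈ M ∩ V, X q ∈ realTangentSpace M q

/-- `X` is an infinitesimal holomorphism of `M` at `p`: a smooth real vector field on a
neighbourhood `M ∩ V` of `p` in `M` whose local flow `exp tX` on `M` near `p` is, for small `t`,
the restriction of a local one-parameter group `Φ` of biholomorphisms of `E`. That `Φ t q` equals
`(exp tX)(q)` for `q ∈ M ∩ U` says that `t ↦ Φ t q` (which starts at `q`) is an integral curve
of `X` in `M ∩ V`. -/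
def IsInfinitesimalHolomorphism (M : Set E) (p : E) (X : E → E) : Prop :=
  ∃ V : Set E, IsOpen V ∧ p ∈ V ∧ IsSmoothVectorFieldOn M X V ∧
    ∃ (Φ : ℝ → E → E) (U : Set E) (ε : ℝ), IsLocalBiholomorphismGroup Φ U ε ∧ p ∈ U ∧
      ∀ q ∈ M ∩ U, ∀ t ∈ Ioo (-ε) ε,
        Φ t q ∈ M ∩ V ∧ HasDerivAt (fun s => Φ s q) (X (Φ t q)) t

/-- `hol(M,p)`: the Lie algebra generated by the infinitesimal holomorphisms of `M` at `p`, that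
is, the smallest real linear space of germs at `p` of vector fields on `M` that contains the germs
of all infinitesimal holomorphisms and is closed under Lie brackets. A germ is taken along `M`
(two fields are identified if they agree at the points of `M` near `p`); the bracket of two smooth
vector fields on `M` is computed from smooth extensions to a neighbourhood of `p`, on whose choice
its values on `M` do not depend. -/
def hol (M : Set E) (p : E) : Submodule ℝ (Germ (𝓝[M] p) E) :=
  sInf {S | (∀ X : E → E, IsInfinitesimalHolomorphism M p X → (X : Germ (𝓝[M] p) E) ∈ S) ∧
    ∀ (X Y : E → E) (V : Set E), IsOpen V → p ∈ V →
      IsSmoothVectorFieldOn M X V → IsSmoothVectorFieldOn M Y V →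
      (X : Germ (𝓝[M] p) E) ∈ S → (Y : Germ (𝓝[M] p) E) ∈ S →
      (VectorField.lieBracket ℝ X Y : Germ (𝓝[M] p) E) ∈ S}

end General

/-- The set `M` of all `(z, w₁, w₂) ∈ ℂ³` with
`Im w₁ = z⁴ z̄¹⁰ + z¹⁰ z̄⁴ + (Re w₁) |z|⁸ + (Re w₂) |z|⁴` and `Im w₂ = 0`. -/
def exampleM : Set (ℂ × ℂ × ℂ) :=
  {x | match x with
    | (z, w₁, w₂) =>
      (w₁.im : ℂ) = z ^ 4 * conj z ^ 10 + z ^ 10 * conj z ^ 4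
        + (w₁.re : ℂ) * (‖z‖ : ℂ) ^ 8 + (w₂.re : ℂ) * (‖z‖ : ℂ) ^ 4 ∧
      w₂.im = 0}

end

/-!
Write `φ(z, z̄, s, t)` for the right-hand side of the first equation, so that `M = exampleM` is the
graph `w₁ = s + iφ`, `w₂ = t`. It is foliated by the leaves `Re w₂ = t`, and solving the
differentiated equations shows that `M` and its leaves both have complex tangent space spanned by
`(1, β, 0)` with `β = 2i φ_z / (1 - i|z|⁸)`. So `M` is CR of CR dimension `1` and nowhere minimal
(`complexTangentSpace_exampleM`, `complexTangentSpace_exampleSlice`).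

A holomorphic field tangent to `M` is `(a, aβ, 0)` on `M`. The antiholomorphic tangent field `L̄`
kills `a` and `aβ`, hence `a · L̄β = 0` (`fst_mul_leviPoly_eq_zero`). Here `L̄β` is the Levi form of
the leaves; it is affine in `t`, and its leading coefficient is a nonzero multiple of
`|z|² (1 - 3|z|¹⁶)`, so that it is nonzero on a dense set and `a = 0`.

For the last claim, an infinitesimal holomorphism is the restriction to `M` of the generator of
the group of biholomorphisms. The generator is a holomorphic field `(f, g, k)`, because the
derivative of a holomorphic map is complex linear and mixed second derivatives commute
(`IsLocalBiholomorphismGroup.differentiableOn_generator`). Its tangency to `M` says that, on `M`,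
`Im k = 0` and `Im g = 2 Re(φ_z f) + |z|⁸ Re g + |z|⁴ Re k`. On a leaf `t ≠ 0`, replace `z̄` by an
independent variable `ζ`, which is allowed by polarization, and compare powers of `ζ`:

* `ζ⁰`: `k` and `g` do not depend on `z` and are real on the real axis, and then `k` is constant;
* `ζ¹`, `ζ²`: `f = z F(w₁)` and `t g' = 2t (F + F̄) + k`;
* `z¹⁰ζ⁴`: `g' = 10 F + 4 F̄`, so that `F` is real and `g' = 14 F`, whence `F = k / (10 t)` is
  constant;
* `z⁴ζ⁴`: `s g' - g = 8 s F`, so that `g = 6 s F`.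

The last two contradict each other unless `F = 0`, and then `g` and `k` vanish as well
(`IsTangentTriple.eq_zero`). The leaf `t = 0` follows by continuity. So all the germs that generate
`hol M 0` are zero, and brackets of germs of fields that vanish along `M` are zero.
-/

noncomputable section

/-! ### Equations, tangent spaces and leaves -/

/-- The polynomial on the right of the first equation of `exampleM`, with `z̄` replaced by an
independent variable `ζ` and with `s`, `t` for the real parts of `w₁`, `w₂`. -/
def defPoly (z ζ s t : ℂ) : ℂ :=
  z ^ 4 * ζ ^ 10 + z ^ 10 * ζ ^ 4 + s * (z ^ 4 * ζ ^ 4) + t * (z ^ 2 * ζ ^ 2)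

/-- The partial derivative of `defPoly` in `z`. Since `defPoly` is symmetric in `z` and `ζ`, the
partial derivative in `ζ` is `defPolyDz ζ z s t`. -/
def defPolyDz (z ζ s t : ℂ) : ℂ :=
  4 * z ^ 3 * ζ ^ 10 + 10 * z ^ 9 * ζ ^ 4 + 4 * s * z ^ 3 * ζ ^ 4 + 2 * t * z * ζ ^ 2

lemma conj_defPoly (z : ℂ) (s t : ℝ) : conj (defPoly z (conj z) s t) = defPoly z (conj z) s t := by
  simp [defPoly]; ring

lemma ofReal_re_defPoly (z : ℂ) (s t : ℝ) :
    (((defPoly z (conj z) s t).re : ℝ) : ℂ) = defPoly z (conj z) s t :=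
  Complex.conj_eq_iff_re.1 (conj_defPoly z s t)

lemma conj_defPolyDz (z : ℂ) (s t : ℝ) :
    conj (defPolyDz z (conj z) s t) = defPolyDz (conj z) z s t := by
  simp only [defPolyDz, map_add, map_mul, map_pow, Complex.conj_conj, Complex.conj_ofReal,
    map_ofNat]

lemma mem_exampleM_iff {x : ℂ × ℂ × ℂ} : x ∈ exampleM ↔
    (x.2.1.im : ℂ) = defPoly x.1 (conj x.1) x.2.1.re x.2.2.re ∧ x.2.2.im = 0 := by
  obtain ⟨z, w₁, w₂⟩ := x
  have h : z * conj z = (‖z‖ : ℂ) ^ 2 := Complex.mul_conj' z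
  have e1 : (‖z‖ : ℂ) ^ 8 = z ^ 4 * conj z ^ 4 := by rw [← mul_pow, h]; ring
  have e2 : (‖z‖ : ℂ) ^ 4 = z ^ 2 * conj z ^ 2 := by rw [← mul_pow, h]; ring
  simp only [exampleM, mem_ofPred_eq, defPoly, e1, e2]

lemma mem_exampleM_iff_re {x : ℂ × ℂ × ℂ} : x ∈ exampleM ↔
    x.2.1.im = (defPoly x.1 (conj x.1) x.2.1.re x.2.2.re).re ∧ x.2.2.im = 0 := by
  rw [mem_exampleM_iff, ← ofReal_re_defPoly, Complex.ofReal_inj]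
  simp

/-- The point of `exampleM` over `(z, s, t)`, which exhibits `exampleM` as a graph over
`z`, `Re w₁`, `Re w₂`. -/
def graphPoint (z : ℂ) (s t : ℝ) : ℂ × ℂ × ℂ :=
  (z, s + Complex.I * defPoly z (conj z) s t, t)

lemma re_graphPoint (z : ℂ) (s t : ℝ) : (graphPoint z s t).2.1.re = s := by
  have h := congrArg Complex.im (ofReal_re_defPoly z s t)
  simp only [Complex.ofReal_im] at h
  simp [graphPoint, ← h]

lemma graphPoint_mem (z : ℂ) (s t : ℝ) : graphPoint z s t ∈ exampleM := by
  rw [mem_exampleM_iff_re]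
  have := ofReal_re_defPoly z s t
  have h2 := congrArg Complex.im this
  simp only [graphPoint, Complex.add_re, Complex.add_im, Complex.ofReal_re, Complex.ofReal_im,
    Complex.I_mul_re, Complex.I_mul_im] at h2 ⊢
  simp [← h2]

lemma eq_graphPoint {x : ℂ × ℂ × ℂ} (hx : x ∈ exampleM) :
    x = graphPoint x.1 x.2.1.re x.2.2.re := by
  obtain ⟨z, w₁, w₂⟩ := x
  obtain ⟨h1, h2⟩ := mem_exampleM_iff.1 hx
  simp only at h1 h2
  simp only [graphPoint, Prod.mk.injEq, true_and, ← h1]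
  refine ⟨?_, ?_⟩
  · apply Complex.ext <;> simp
  · apply Complex.ext <;> simp [h2]

lemma HasDerivAt.defPoly {a b c d : ℝ → ℂ} {a' b' c' d' : ℂ} {x : ℝ} (ha : HasDerivAt a a' x)
    (hb : HasDerivAt b b' x) (hc : HasDerivAt c c' x) (hd : HasDerivAt d d' x) :
    HasDerivAt (fun y => defPoly (a y) (b y) (c y) (d y))
      (defPolyDz (a x) (b x) (c x) (d x) * a' + defPolyDz (b x) (a x) (c x) (d x) * b'
        + a x ^ 4 * b x ^ 4 * c' + a x ^ 2 * b x ^ 2 * d') x := by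
  have h := ((((ha.fun_pow 4).fun_mul (hb.fun_pow 10)).fun_add
    ((ha.fun_pow 10).fun_mul (hb.fun_pow 4))).fun_add
    (hc.fun_mul ((ha.fun_pow 4).fun_mul (hb.fun_pow 4)))).fun_add
    (hd.fun_mul ((ha.fun_pow 2).fun_mul (hb.fun_pow 2)))
  refine h.congr_deriv ?_
  simp only [defPolyDz]
  push_cast
  ring

lemma HasDerivAt.complexConj {a : ℝ → ℂ} {a' : ℂ} {x : ℝ} (ha : HasDerivAt a a' x) :
    HasDerivAt (fun y => conj (a y)) (conj a') x :=
  (Complex.conjCLE : ℂ →L[ℝ] ℂ).hasFDerivAt.comp_hasDerivAt x ha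

lemma HasDerivAt.complexRe {a : ℝ → ℂ} {a' : ℂ} {x : ℝ} (ha : HasDerivAt a a' x) :
    HasDerivAt (fun y => (a y).re) a'.re x :=
  Complex.reCLM.hasFDerivAt.comp_hasDerivAt x ha

lemma HasDerivAt.complexIm {a : ℝ → ℂ} {a' : ℂ} {x : ℝ} (ha : HasDerivAt a a' x) :
    HasDerivAt (fun y => (a y).im) a'.im x :=
  Complex.imCLM.hasFDerivAt.comp_hasDerivAt x ha

/-- The leaf `Re w₂ = c` of `exampleM`. -/
def exampleSlice (c : ℝ) : Set (ℂ × ℂ × ℂ) := {x ∈ exampleM | x.2.2.re = c}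

lemma realTangentSpace_mono {E : Type*} [NormedAddCommGroup E] [NormedSpace ℂ E] {M N : Set E}
    (h : N ⊆ M) (p : E) : realTangentSpace N p ≤ realTangentSpace M p := by
  refine Submodule.span_mono ?_
  rintro v ⟨γ, h1, h2, h3, h4⟩
  exact ⟨γ, h1, h2, h3.mono fun t ht => h ht, h4⟩

lemma complexTangentSpace_mono {E : Type*} [NormedAddCommGroup E] [NormedSpace ℂ E] {M N : Set E}
    (h : N ⊆ M) (p : E) : complexTangentSpace N p ≤ complexTangentSpace M p :=
  fun _ hv => ⟨realTangentSpace_mono h p hv.1, realTangentSpace_mono h p hv.2⟩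

/-- The differentiated equations of `exampleM` hold for tangent vectors. -/
lemma im_eq_of_mem_realTangentSpace {q v : ℂ × ℂ × ℂ} (hv : v ∈ realTangentSpace exampleM q) :
    (v.2.1.im : ℂ) = defPolyDz q.1 (conj q.1) q.2.1.re q.2.2.re * v.1
      + defPolyDz (conj q.1) q.1 q.2.1.re q.2.2.re * conj v.1
      + q.1 ^ 4 * conj q.1 ^ 4 * v.2.1.re + q.1 ^ 2 * conj q.1 ^ 2 * v.2.2.re ∧ v.2.2.im = 0 := by
  induction hv using Submodule.span_induction with
  | mem v hv =>
    obtain ⟨γ, -, h0, hM, hγ⟩ := hv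
    have d1 : HasDerivAt (fun t => (γ t).1) v.1 0 := hγ.fst
    have d2 : HasDerivAt (fun t => (γ t).2.1) v.2.1 0 := hγ.snd.fst
    have d3 : HasDerivAt (fun t => (γ t).2.2) v.2.2 0 := hγ.snd.snd
    have e1 := HasDerivAt.defPoly d1 d1.complexConj d2.complexRe.ofReal_comp
      d3.complexRe.ofReal_comp
    have e2 := d2.complexIm.ofReal_comp
    have e3 := d3.complexIm
    simp only [h0] at e1
    refine ⟨?_, ?_⟩
    · refine (e2.congr_of_eventuallyEq ?_).unique e1
      filter_upwards [hM] with t ht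
      exact (mem_exampleM_iff.1 ht).1.symm
    · refine (e3.congr_of_eventuallyEq ?_).unique (hasDerivAt_const (0 : ℝ) (0 : ℝ))
      filter_upwards [hM] with t ht
      exact (mem_exampleM_iff.1 ht).2.symm
  | zero => simp
  | add v w _ _ h1 h2 =>
    obtain ⟨h1, h1'⟩ := h1
    obtain ⟨h2, h2'⟩ := h2
    refine ⟨?_, by simp [h1', h2']⟩
    simp only [Prod.fst_add, Prod.snd_add, Complex.add_im, Complex.add_re, Complex.ofReal_add,
      map_add, h1, h2]
    ring
  | smul r v _ h =>
    obtain ⟨h, h'⟩ := h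
    refine ⟨?_, by simp [h']⟩
    simp only [Prod.smul_fst, Prod.smul_snd, Complex.real_smul, map_mul, Complex.conj_ofReal,
      Complex.re_ofReal_mul, Complex.im_ofReal_mul, Complex.ofReal_mul, h]
    ring

/-- The complex tangent vectors of `exampleM` at the point over `(z, s, t)` are the multiples of
`(1, crSlope z s t, 0)`. -/
def crSlope (z : ℂ) (s t : ℝ) : ℂ :=
  2 * Complex.I * defPolyDz z (conj z) s t / (1 - Complex.I * (z ^ 4 * conj z ^ 4))

lemma pow_mul_conj_pow (z : ℂ) (n : ℕ) : z ^ n * conj z ^ n = ((Complex.normSq z ^ n : ℝ) : ℂ) := by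
  rw [← mul_pow, Complex.mul_conj]; push_cast; rfl

lemma one_sub_I_mul_ne_zero (r : ℝ) : 1 - Complex.I * (r : ℂ) ≠ 0 := by
  intro h
  simpa using congrArg Complex.re h

lemma eq_of_mem_complexTangentSpace {q v : ℂ × ℂ × ℂ}
    (hv : v ∈ complexTangentSpace exampleM q) :
    v.2.1 = crSlope q.1 q.2.1.re q.2.2.re * v.1 ∧ v.2.2 = 0 := by
  obtain ⟨h1, h2⟩ := hv
  obtain ⟨h1, h1'⟩ := im_eq_of_mem_realTangentSpace h1
  obtain ⟨h2, h2'⟩ := im_eq_of_mem_realTangentSpace h2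
  have h3 : v.2.2.re = 0 := by simpa using h2'
  refine ⟨?_, Complex.ext h3 h1'⟩
  simp only [Prod.smul_snd, Prod.smul_fst, smul_eq_mul, Complex.I_mul_im, Complex.I_mul_re, h1', h3,
    Complex.ofReal_neg, map_mul, Complex.conj_I] at h1 h2
  have h4 : (v.2.1.re : ℂ) + v.2.1.im * Complex.I = v.2.1 := Complex.re_add_im _
  have hne : 1 - Complex.I * (q.1 ^ 4 * conj q.1 ^ 4) ≠ 0 := by
    rw [pow_mul_conj_pow]; exact one_sub_I_mul_ne_zero _
  rw [crSlope, div_mul_eq_mul_div, eq_div_iff hne]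
  set A := defPolyDz q.1 (conj q.1) q.2.1.re q.2.2.re
  set B := defPolyDz (conj q.1) q.1 q.2.1.re q.2.2.re
  rw [← h4]
  push_cast at h1 h2
  linear_combination Complex.I * h1 + h2 +
    (- v.2.1.im * (q.1 ^ 4 * conj q.1 ^ 4)) * Complex.I_sq

/-- A vector `(a, b, 0)` that satisfies the differentiated equations is the velocity of a curve in a
leaf. -/
lemma hasDerivAt_graphPoint {z a b : ℂ} {s t : ℝ}
    (h : (b.im : ℂ) = defPolyDz z (conj z) s t * a + defPolyDz (conj z) z s t * conj a
      + z ^ 4 * conj z ^ 4 * b.re) :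
    HasDerivAt (fun τ : ℝ => graphPoint (z + τ * a) (s + τ * b.re) t) (a, b, 0) 0 := by
  have d0 : HasDerivAt (fun τ : ℝ => (τ : ℂ)) 1 0 := Complex.ofRealCLM.hasDerivAt
  have d1 : HasDerivAt (fun τ : ℝ => z + τ * a) a 0 := by
    simpa using (d0.mul_const a).const_add z
  have d2 : HasDerivAt (fun τ : ℝ => ((s + τ * b.re : ℝ) : ℂ)) b.re 0 := by
    simpa using (d0.mul_const (b.re : ℂ)).const_add (s : ℂ)
  have d3 := HasDerivAt.defPoly d1 d1.complexConj d2 (hasDerivAt_const (0 : ℝ) (t : ℂ))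
  have d4 := d1.prodMk ((d2.add (d3.const_mul Complex.I)).prodMk
    (hasDerivAt_const (0 : ℝ) (t : ℂ)))
  refine d4.congr_deriv ?_
  simp only [Complex.ofReal_zero, zero_mul, add_zero, mul_zero, ← h, mul_comm Complex.I,
    Complex.re_add_im]

lemma mem_realTangentSpace_exampleSlice {q : ℂ × ℂ × ℂ} (hq : q ∈ exampleM) {a b : ℂ}
    (h : (b.im : ℂ) = defPolyDz q.1 (conj q.1) q.2.1.re q.2.2.re * a
      + defPolyDz (conj q.1) q.1 q.2.1.re q.2.2.re * conj a
      + q.1 ^ 4 * conj q.1 ^ 4 * b.re) :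
    ((a, b, 0) : ℂ × ℂ × ℂ) ∈ realTangentSpace (exampleSlice q.2.2.re) q := by
  refine Submodule.subset_span ⟨fun τ => graphPoint (q.1 + τ * a) (q.2.1.re + τ * b.re) q.2.2.re,
    ?_, ?_, Eventually.of_forall fun τ => ⟨graphPoint_mem _ _ _, by simp [graphPoint]⟩, ?_⟩
  · have c0 : ContDiff ℝ ∞ (fun τ : ℝ => (τ : ℂ)) := Complex.ofRealCLM.contDiff
    have c1 : ContDiff ℝ ∞ (fun τ : ℝ => q.1 + τ * a) := by fun_prop
    have c2 : ContDiff ℝ ∞ (fun τ : ℝ => conj (q.1 + τ * a)) :=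
      (Complex.conjCLE : ℂ →L[ℝ] ℂ).contDiff.comp c1
    have c3 : ContDiff ℝ ∞ (fun τ : ℝ => ((q.2.1.re + τ * b.re : ℝ) : ℂ)) := by
      push_cast; fun_prop
    have c4 : ContDiff ℝ ∞ (fun τ : ℝ =>
        graphPoint (q.1 + τ * a) (q.2.1.re + τ * b.re) q.2.2.re) := by
      unfold graphPoint defPoly
      exact c1.prodMk ((c3.add (contDiff_const.mul ((((c1.pow 4).mul (c2.pow 10)).add
        ((c1.pow 10).mul (c2.pow 4))).add (c3.mul ((c1.pow 4).mul (c2.pow 4))) |>.add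
        (contDiff_const.mul ((c1.pow 2).mul (c2.pow 2)))))).prodMk contDiff_const)
    exact c4.contDiffAt
  · simpa using (eq_graphPoint hq).symm
  · exact hasDerivAt_graphPoint h

/-- Both `(1, β, 0)` and `i (1, β, 0)`, for `β` the `crSlope`, satisfy the differentiated equations
of `exampleM`. -/
lemma im_crSlope (z : ℂ) (s t : ℝ) :
    ((crSlope z s t).im : ℂ) = defPolyDz z (conj z) s t * 1 + defPolyDz (conj z) z s t * conj 1
        + z ^ 4 * conj z ^ 4 * (crSlope z s t).re ∧
    ((Complex.I * crSlope z s t).im : ℂ) = defPolyDz z (conj z) s t * Complex.I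
        + defPolyDz (conj z) z s t * conj Complex.I
        + z ^ 4 * conj z ^ 4 * (Complex.I * crSlope z s t).re := by
  have hA := conj_defPolyDz z s t
  set β := crSlope z s t with hβ
  have h1 : β * (1 - Complex.I * (z ^ 4 * conj z ^ 4)) =
      2 * Complex.I * defPolyDz z (conj z) s t := by
    rw [hβ, crSlope, div_mul_cancel₀]
    rw [pow_mul_conj_pow]; exact one_sub_I_mul_ne_zero _
  have h2 := congrArg conj h1
  simp only [map_mul, map_sub, map_one, Complex.conj_I, hA, map_pow, Complex.conj_conj,
    map_ofNat] at h2
  have h3 : (β.re : ℂ) = (β + conj β) / 2 := Complex.re_eq_add_conj β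
  have h4 : (β.im : ℂ) = - Complex.I * (β - conj β) / 2 := by
    rw [Complex.im_eq_sub_conj β]; field_simp; rw [Complex.I_sq]; ring
  constructor
  · rw [h3, h4, map_one]
    linear_combination (-Complex.I / 2) * h1 + (Complex.I / 2) * h2 -
      (defPolyDz z (conj z) s t + defPolyDz (conj z) z s t
        + (β + conj β) * (z ^ 4 * conj z ^ 4) / 2) * Complex.I_sq
  · simp only [Complex.I_mul_im, Complex.I_mul_re, Complex.ofReal_neg, Complex.conj_I]
    rw [h3, h4]
    linear_combination (1 / 2) * h1 + (1 / 2) * h2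

lemma mem_complexTangentSpace_exampleSlice {q : ℂ × ℂ × ℂ} (hq : q ∈ exampleM) :
    ((1, crSlope q.1 q.2.1.re q.2.2.re, 0) : ℂ × ℂ × ℂ) ∈
      complexTangentSpace (exampleSlice q.2.2.re) q := by
  obtain ⟨h1, h2⟩ := im_crSlope q.1 q.2.1.re q.2.2.re
  refine ⟨mem_realTangentSpace_exampleSlice hq h1, ?_⟩
  have e : Complex.I • ((1, crSlope q.1 q.2.1.re q.2.2.re, 0) : ℂ × ℂ × ℂ) =
      (Complex.I, Complex.I * crSlope q.1 q.2.1.re q.2.2.re, 0) := by simp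
  rw [e]
  exact mem_realTangentSpace_exampleSlice hq h2

lemma complexTangentSpace_exampleM {q : ℂ × ℂ × ℂ} (hq : q ∈ exampleM) :
    complexTangentSpace exampleM q = Submodule.span ℂ {(1, crSlope q.1 q.2.1.re q.2.2.re, 0)} := by
  refine le_antisymm (fun v hv => ?_) ?_
  · obtain ⟨h1, h2⟩ := eq_of_mem_complexTangentSpace hv
    refine Submodule.mem_span_singleton.2 ⟨v.1, ?_⟩
    ext <;> simp [h1, h2, mul_comm]
  · rw [Submodule.span_singleton_le_iff_mem]
    exact complexTangentSpace_mono (fun x hx => hx.1) q (mem_complexTangentSpace_exampleSlice hq)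

/-- The leaves have the same complex tangent spaces as `exampleM`; this is why `exampleM` is nowhere
minimal. -/
lemma complexTangentSpace_exampleSlice {q : ℂ × ℂ × ℂ} (hq : q ∈ exampleM) :
    complexTangentSpace (exampleSlice q.2.2.re) q =
      Submodule.span ℂ {(1, crSlope q.1 q.2.1.re q.2.2.re, 0)} := by
  refine le_antisymm ?_ ?_
  · rw [← complexTangentSpace_exampleM hq]
    exact complexTangentSpace_mono (fun x hx => hx.1) q
  · rw [Submodule.span_singleton_le_iff_mem]
    exact mem_complexTangentSpace_exampleSlice hq

/-- The first defining function of `exampleM`. -/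
def exampleRho (x : ℂ × ℂ × ℂ) : ℝ :=
  x.2.1.im - (defPoly x.1 (conj x.1) x.2.1.re x.2.2.re).re

lemma analyticAt_exampleRho (x : ℂ × ℂ × ℂ) : AnalyticAt ℝ exampleRho x := by
  have a1 : AnalyticAt ℝ (fun x : ℂ × ℂ × ℂ => x.1) x := analyticAt_fst
  have a2 : AnalyticAt ℝ (fun x : ℂ × ℂ × ℂ => x.2.1) x := analyticAt_fst.comp analyticAt_snd
  have a3 : AnalyticAt ℝ (fun x : ℂ × ℂ × ℂ => x.2.2) x := analyticAt_snd.comp analyticAt_snd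
  have b1 : AnalyticAt ℝ (fun x : ℂ × ℂ × ℂ => conj x.1) x :=
    ((Complex.conjCLE : ℂ →L[ℝ] ℂ).analyticAt _).comp a1
  have b2 : AnalyticAt ℝ (fun x : ℂ × ℂ × ℂ => (x.2.1.re : ℂ)) x :=
    (((Complex.ofRealCLM).comp Complex.reCLM).analyticAt _).comp a2
  have b3 : AnalyticAt ℝ (fun x : ℂ × ℂ × ℂ => (x.2.2.re : ℂ)) x :=
    (((Complex.ofRealCLM).comp Complex.reCLM).analyticAt _).comp a3
  have c : AnalyticAt ℝ (fun x : ℂ × ℂ × ℂ => defPoly x.1 (conj x.1) x.2.1.re x.2.2.re) x :=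
    ((((a1.pow 4).mul (b1.pow 10)).add ((a1.pow 10).mul (b1.pow 4))).add
      (b2.mul ((a1.pow 4).mul (b1.pow 4)))).add (b3.mul ((a1.pow 2).mul (b1.pow 2)))
  exact ((Complex.imCLM.analyticAt _).comp a2).sub ((Complex.reCLM.analyticAt _).comp c)

lemma fderiv_apply_eq_of_line {E : Type*} [NormedAddCommGroup E] [NormedSpace ℝ E] {f : E → ℝ}
    {x v : E} {a : ℝ} (hf : AnalyticAt ℝ f x) (h : ∀ t : ℝ, f (x + t • v) = f x + t * a) :
    fderiv ℝ f x v = a := by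
  refine (hf.differentiableAt.hasFDerivAt.hasLineDerivAt v).unique ?_
  have : HasDerivAt (fun t : ℝ => f x + t * a) a 0 := by
    simpa using ((hasDerivAt_id (0 : ℝ)).mul_const a).const_add (f x)
  unfold HasLineDerivAt
  simpa only [h] using this

lemma fderiv_exampleRho_I (x : ℂ × ℂ × ℂ) : fderiv ℝ exampleRho x (0, Complex.I, 0) = 1 :=
  fderiv_apply_eq_of_line (analyticAt_exampleRho x) fun t => by
    simp [exampleRho]; ring

lemma fderiv_exampleRho_snd_I (x : ℂ × ℂ × ℂ) : fderiv ℝ exampleRho x (0, 0, Complex.I) = 0 :=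
  fderiv_apply_eq_of_line (analyticAt_exampleRho x) fun t => by
    simp [exampleRho]

/-- The coordinate `Im w₂`. -/
def imCoord : ℂ × ℂ × ℂ →L[ℝ] ℝ :=
  Complex.imCLM.comp ((ContinuousLinearMap.snd ℝ ℂ ℂ).comp (ContinuousLinearMap.snd ℝ ℂ (ℂ × ℂ)))

/-- The coordinate `Re w₂`. -/
def reCoord : ℂ × ℂ × ℂ →L[ℝ] ℝ :=
  Complex.reCLM.comp ((ContinuousLinearMap.snd ℝ ℂ ℂ).comp (ContinuousLinearMap.snd ℝ ℂ (ℂ × ℂ)))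

lemma isRealAnalyticSubmanifold_exampleM : IsRealAnalyticSubmanifold exampleM 2 := by
  refine fun p _ => ⟨univ, isOpen_univ, mem_univ p, ![exampleRho, imCoord], ?_, ?_, ?_⟩
  · intro j x _
    fin_cases j
    · exact analyticAt_exampleRho x
    · exact imCoord.analyticAt x
  · intro x _
    rw [Fintype.linearIndependent_iff]
    intro g hg
    rw [Fin.sum_univ_two] at hg
    have h1 := congrArg (fun L : ℂ × ℂ × ℂ →L[ℝ] ℝ => L (0, Complex.I, 0)) hg
    have h2 := congrArg (fun L : ℂ × ℂ × ℂ →L[ℝ] ℝ => L (0, 0, Complex.I)) hg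
    simp [fderiv_exampleRho_I, imCoord] at h1
    simp [fderiv_exampleRho_snd_I, imCoord] at h2
    intro i
    fin_cases i
    · exact h1
    · exact h2
  · ext x
    simp [mem_exampleM_iff_re, exampleRho, imCoord, Fin.forall_fin_two, sub_eq_zero]

lemma isRealAnalyticSubmanifold_exampleSlice (c : ℝ) :
    IsRealAnalyticSubmanifold (exampleSlice c) 3 := by
  refine fun p _ => ⟨univ, isOpen_univ, mem_univ p,
    ![exampleRho, imCoord, fun x => reCoord x - c], ?_, ?_, ?_⟩
  · intro j x _
    fin_cases j
    · exact analyticAt_exampleRho x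
    · exact imCoord.analyticAt x
    · exact (reCoord.analyticAt x).sub analyticAt_const
  · intro x _
    rw [Fintype.linearIndependent_iff]
    intro g hg
    have hr : fderiv ℝ (fun x => reCoord x - c) x = reCoord := by
      rw [fderiv_sub_const, ContinuousLinearMap.fderiv]
    simp only [Fin.sum_univ_three, Matrix.cons_val_zero, Matrix.cons_val_one, Matrix.cons_val,
      hr, ContinuousLinearMap.fderiv] at hg
    have h1 := congrArg (fun L : ℂ × ℂ × ℂ →L[ℝ] ℝ => L (0, Complex.I, 0)) hg
    have h2 := congrArg (fun L : ℂ × ℂ × ℂ →L[ℝ] ℝ => L (0, 0, Complex.I)) hg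
    have h3 := congrArg (fun L : ℂ × ℂ × ℂ →L[ℝ] ℝ => L (0, 0, 1)) hg
    simp [fderiv_exampleRho_I, imCoord, reCoord] at h1
    simp [fderiv_exampleRho_snd_I, imCoord, reCoord] at h2
    simp [h1, imCoord, reCoord] at h3
    intro i
    fin_cases i
    · exact h1
    · exact h2
    · exact h3
  · ext x
    simp [exampleSlice, mem_exampleM_iff_re, exampleRho, imCoord, reCoord, Fin.forall_fin_succ,
      sub_eq_zero, and_assoc]

lemma finrank_span_tangent (b : ℂ) :
    Module.finrank ℂ (Submodule.span ℂ {((1, b, 0) : ℂ × ℂ × ℂ)}) = 1 :=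
  finrank_span_singleton (by simp)

lemma isCRSubmanifold_exampleM : IsCRSubmanifold exampleM 2 1 where
  submanifold := isRealAnalyticSubmanifold_exampleM
  finrank_eq p hp := by rw [complexTangentSpace_exampleM hp, finrank_span_tangent]

lemma isCRSubmanifold_exampleSlice (c : ℝ) : IsCRSubmanifold (exampleSlice c) 3 1 where
  submanifold := isRealAnalyticSubmanifold_exampleSlice c
  finrank_eq p hp := by
    obtain ⟨hp, rfl⟩ := hp
    rw [complexTangentSpace_exampleSlice hp, finrank_span_tangent]

lemma not_isMinimalAt_exampleM {p : ℂ × ℂ × ℂ} (hp : p ∈ exampleM) : ¬ IsMinimalAt exampleM p :=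
  fun h => h 2 1 isCRSubmanifold_exampleM ⟨exampleSlice p.2.2.re, 3, fun _ hx => hx.1, ⟨hp, rfl⟩,
    by norm_num, isCRSubmanifold_exampleSlice _⟩

/-! ### The Levi form and holomorphic nondegeneracy -/

/-- Up to a nowhere vanishing factor, the derivative of `crSlope` along the antiholomorphic vector
field `∂/∂z̄ + (β̄/2) ∂/∂s` tangent to the leaves, that is, the Levi form of the leaf, again with
`z̄` replaced by `ζ`. -/
def leviPoly (z ζ s t : ℂ) : ℂ :=
  2 * (40 * z ^ 3 * ζ ^ 9 + 40 * z ^ 9 * ζ ^ 3 + 16 * s * z ^ 3 * ζ ^ 3 + 4 * t * z * ζ)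
      * (1 - Complex.I * (z ^ 4 * ζ ^ 4)) * (1 + Complex.I * (z ^ 4 * ζ ^ 4))
    - 8 * Complex.I * z ^ 3 * ζ ^ 4 * defPolyDz ζ z s t * (1 - Complex.I * (z ^ 4 * ζ ^ 4))
    + 8 * Complex.I * z ^ 4 * ζ ^ 3 * defPolyDz z ζ s t * (1 + Complex.I * (z ^ 4 * ζ ^ 4))

/-- The Levi form is affine in `t`, with leading coefficient `8 |z|² (1 - 3 |z|¹⁶)`. -/
lemma leviPoly_sub (z ζ s t t' : ℂ) :
    leviPoly z ζ s t - leviPoly z ζ s t' = (t - t') * (8 * (z * ζ) * (1 - 3 * (z * ζ) ^ 8)) := by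
  simp only [leviPoly, defPolyDz]
  linear_combination (24 * (t - t') * (z * ζ) ^ 9) * Complex.I_sq

lemma HasDerivAt.crSlope {a : ℝ → ℂ} {b : ℝ → ℝ} {a' : ℂ} {b' : ℝ} {x t : ℝ}
    (ha : HasDerivAt a a' x) (hb : HasDerivAt b b' x) :
    HasDerivAt (fun y => crSlope (a y) (b y) t)
      (2 * Complex.I * (((12 * a x ^ 2 * conj (a x) ^ 10 + 90 * a x ^ 8 * conj (a x) ^ 4
            + 12 * b x * a x ^ 2 * conj (a x) ^ 4 + 2 * t * conj (a x) ^ 2) * a'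
          + (40 * a x ^ 3 * conj (a x) ^ 9 + 40 * a x ^ 9 * conj (a x) ^ 3
            + 16 * b x * a x ^ 3 * conj (a x) ^ 3 + 4 * t * a x * conj (a x)) * conj a'
          + 4 * a x ^ 3 * conj (a x) ^ 4 * b') * (1 - Complex.I * (a x ^ 4 * conj (a x) ^ 4))
        + defPolyDz (a x) (conj (a x)) (b x) t * (Complex.I *
          (4 * a x ^ 3 * conj (a x) ^ 4 * a' + 4 * a x ^ 4 * conj (a x) ^ 3 * conj a')))
        / (1 - Complex.I * (a x ^ 4 * conj (a x) ^ 4)) ^ 2) x := by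
  have hc := ha.complexConj
  have hd := hb.ofReal_comp
  have hn := (((((ha.fun_pow 3).const_mul 4).fun_mul (hc.fun_pow 10)).fun_add
    (((ha.fun_pow 9).const_mul 10).fun_mul (hc.fun_pow 4))).fun_add
    (((hd.const_mul 4).fun_mul (ha.fun_pow 3)).fun_mul (hc.fun_pow 4))).fun_add
    ((ha.const_mul (2 * (t : ℂ))).fun_mul (hc.fun_pow 2))
  have hm := (((ha.fun_pow 4).fun_mul (hc.fun_pow 4)).const_mul Complex.I).const_sub 1
  have hne : 1 - Complex.I * (a x ^ 4 * conj (a x) ^ 4) ≠ 0 := by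
    rw [pow_mul_conj_pow]; exact one_sub_I_mul_ne_zero _
  refine ((hn.const_mul (2 * Complex.I)).fun_div hm hne).congr_deriv ?_
  congr 1
  simp only [defPolyDz]
  push_cast
  ring

/-- If `Y = (a, b, 0)` is holomorphic and tangent to `exampleM`, then `b = a β` on `exampleM`, where
`β` is the `crSlope`. The antiholomorphic tangent vector field kills `a` and `b`, so that it leaves
`a` times the Levi form equal to zero. -/
lemma fst_mul_leviPoly_eq_zero {U : Set (ℂ × ℂ × ℂ)} (hU : IsOpen U)
    {Y : ℂ × ℂ × ℂ → ℂ × ℂ × ℂ} (hY : DifferentiableOn ℂ Y U)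
    (hT : ∀ q ∈ exampleM ∩ U, Y q ∈ complexTangentSpace exampleM q) {z : ℂ} {s t : ℝ}
    (hq : graphPoint z s t ∈ U) : (Y (graphPoint z s t)).1 * leviPoly z (conj z) s t = 0 := by
  set β := crSlope z s t with hβ
  obtain ⟨h1, h2⟩ := im_crSlope z s t
  have d1 := hasDerivAt_graphPoint h1
  have d2 := hasDerivAt_graphPoint h2
  set L := fderiv ℂ Y (graphPoint z s t)
  have hL : HasFDerivAt Y (L.restrictScalars ℝ) (graphPoint z s t) :=
    ((hY.differentiableAt (hU.mem_nhds hq)).hasFDerivAt).restrictScalars ℝ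
  -- `b = a β` holds along every curve in `M`
  have key : ∀ a b : ℂ, HasDerivAt (fun τ : ℝ => graphPoint (z + τ * a) (s + τ * b.re) t)
      (a, b, 0) 0 → ∀ β', HasDerivAt (fun τ : ℝ => crSlope (z + τ * a) (s + τ * b.re) t) β' 0 →
      (L (a, b, 0)).2.1 = (L (a, b, 0)).1 * β + (Y (graphPoint z s t)).1 * β' := by
    intro a b hd β' hβ'
    have e0 : graphPoint (z + (0 : ℝ) * a) (s + 0 * b.re) t = graphPoint z s t := by simp
    have c : HasDerivAt (fun τ : ℝ => Y (graphPoint (z + τ * a) (s + τ * b.re) t))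
        (L (a, b, 0)) 0 := by
      refine HasFDerivAt.comp_hasDerivAt (0 : ℝ) (l' := L.restrictScalars ℝ) ?_ hd
      rw [e0]; exact hL
    have c1 : HasDerivAt (fun τ : ℝ => (Y (graphPoint (z + τ * a) (s + τ * b.re) t)).1)
        (L (a, b, 0)).1 0 := c.fst
    have c2 : HasDerivAt (fun τ : ℝ => (Y (graphPoint (z + τ * a) (s + τ * b.re) t)).2.1)
        (L (a, b, 0)).2.1 0 := c.snd.fst
    have c3 := c1.fun_mul hβ'
    simp only [Complex.ofReal_zero, zero_mul, add_zero] at c3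
    refine (c2.congr_of_eventuallyEq ?_).unique c3
    have : ∀ᶠ τ : ℝ in 𝓝 0, graphPoint (z + τ * a) (s + τ * b.re) t ∈ U :=
      hd.continuousAt.eventually_mem (hU.mem_nhds (by simpa using hq))
    filter_upwards [this] with τ hτ
    have := (eq_of_mem_complexTangentSpace (hT _ ⟨graphPoint_mem _ _ _, hτ⟩)).1
    rw [this, mul_comm, re_graphPoint]
    simp [graphPoint]
  have d0 : HasDerivAt (fun τ : ℝ => (τ : ℂ)) 1 0 := Complex.ofRealCLM.hasDerivAt
  have dz (a : ℂ) : HasDerivAt (fun τ : ℝ => z + τ * a) a 0 := by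
    simpa using (d0.mul_const a).const_add z
  have ds (r : ℝ) : HasDerivAt (fun τ : ℝ => s + τ * r) r 0 := by
    simpa using ((hasDerivAt_id (0 : ℝ)).mul_const r).const_add s
  have k1 := key _ _ d1 _ ((dz _).crSlope (ds _))
  have k2 := key _ _ d2 _ ((dz _).crSlope (ds _))
  have hI : L (Complex.I, Complex.I * β, 0) = Complex.I • L (1, β, 0) := by
    rw [← map_smul]; simp
  rw [hI] at k2
  simp only [Complex.ofReal_zero, zero_mul, add_zero, Prod.smul_fst, Prod.smul_snd, smul_eq_mul,
    map_one, Complex.conj_I, Complex.I_mul_re, Complex.ofReal_neg, ← hβ] at k1 k2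
  have hne : 1 - Complex.I * (z ^ 4 * conj z ^ 4) ≠ 0 := by
    rw [pow_mul_conj_pow]; exact one_sub_I_mul_ne_zero _
  have hβc : conj β * (1 + Complex.I * (z ^ 4 * conj z ^ 4)) =
      -2 * Complex.I * defPolyDz (conj z) z s t := by
    have h1 : β * (1 - Complex.I * (z ^ 4 * conj z ^ 4)) =
        2 * Complex.I * defPolyDz z (conj z) s t := by
      rw [hβ, crSlope, div_mul_cancel₀ _ hne]
    have h2 := congrArg conj h1
    simp only [map_mul, map_sub, map_one, Complex.conj_I, conj_defPolyDz, map_pow,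
      Complex.conj_conj, map_ofNat] at h2
    linear_combination h2
  have hconj : conj β = (β.re : ℂ) - β.im * Complex.I := by
    apply Complex.ext <;> simp
  rw [hconj] at hβc
  -- eliminating the derivatives of `Y` leaves the derivative of the slope along the
  -- antiholomorphic direction
  have elim {A B E E' D : ℂ} (hD : D ≠ 0)
      (h : B = A * β + (Y (graphPoint z s t)).1 * (2 * Complex.I * E / D ^ 2))
      (h' : Complex.I * B =
        Complex.I * A * β + (Y (graphPoint z s t)).1 * (2 * Complex.I * E' / D ^ 2)) :
      (Y (graphPoint z s t)).1 * (E' - Complex.I * E) = 0 := by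
    have h3 : 2 * Complex.I / D ^ 2 * ((Y (graphPoint z s t)).1 * (E' - Complex.I * E)) = 0 := by
      linear_combination Complex.I * h - h'
    simpa [hD] using h3
  have k3 := elim hne k1 k2
  simp only [leviPoly]
  set N := defPolyDz z (conj z) s t
  set D := 1 - Complex.I * (z ^ 4 * conj z ^ 4)
  set D' := 1 + Complex.I * (z ^ 4 * conj z ^ 4)
  linear_combination Complex.I * D' * k3
    - (Y (graphPoint z s t)).1 * (4 * z ^ 3 * conj z ^ 4) * D * hβc
    + (Y (graphPoint z s t)).1 * D' * (2 * (40 * z ^ 3 * conj z ^ 9 + 40 * z ^ 9 * conj z ^ 3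
        + 16 * s * z ^ 3 * conj z ^ 3 + 4 * t * z * conj z) * D
      + 4 * z ^ 3 * conj z ^ 4 * β.re * D + 8 * Complex.I * N * z ^ 4 * conj z ^ 3) * Complex.I_sq

/-- The Levi form is nonzero on a dense set, even for fixed `s`. -/
lemma exists_leviPoly_ne_zero {W : Set (ℂ × ℝ)} (hW : IsOpen W) (hne : W.Nonempty) (s : ℂ) :
    ∃ x ∈ W, leviPoly x.1 (conj x.1) s x.2 ≠ 0 := by
  by_contra! h
  obtain ⟨⟨z₀, t₀⟩, h0⟩ := hne
  have h1 : ∀ᶠ x : ℂ × ℝ in 𝓝 (z₀, t₀), leviPoly x.1 (conj x.1) s x.2 = 0 := by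
    filter_upwards [hW.mem_nhds h0] with x hx using h x hx
  rw [nhds_prod_eq] at h1
  -- the polynomial is affine in `t`, so that its leading coefficient in `t` vanishes
  have h2 : ∀ᶠ z in 𝓝 z₀, Complex.normSq z * (1 - 3 * Complex.normSq z ^ 8) = 0 := by
    filter_upwards [h1.curry] with z hz
    obtain ⟨t, ht, htne⟩ := ((hz.filter_mono nhdsWithin_le_nhds).and
      (self_mem_nhdsWithin (s := {t₀}ᶜ))).exists
    have h3 := leviPoly_sub z (conj z) s t t₀
    rw [ht, hz.self_of_nhds, sub_zero, eq_comm, mul_eq_zero] at h3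
    have h4 := h3.resolve_left (by rw [sub_eq_zero]; exact_mod_cast htne)
    rw [Complex.mul_conj] at h4
    have h5 : Complex.normSq z = 0 ∨ 1 - 3 * Complex.normSq z ^ 8 = 0 := by
      simp only [mul_eq_zero, OfNat.ofNat_ne_zero, false_or] at h4
      exact h4.imp (fun h => by exact_mod_cast h) (fun h => by exact_mod_cast h)
    exact mul_eq_zero.2 h5
  have h3 : ∀ᶠ x : ℝ in 𝓝 z₀.re,
      (x ^ 2 + z₀.im ^ 2) * (1 - 3 * (x ^ 2 + z₀.im ^ 2) ^ 8) = 0 := by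
    have hc : Continuous fun x : ℝ => (⟨x, z₀.im⟩ : ℂ) := by
      have : (fun x : ℝ => (⟨x, z₀.im⟩ : ℂ)) = fun x : ℝ => (x : ℂ) + z₀.im * Complex.I := by
        ext x; exact Complex.mk_eq_add_mul_I _ _
      rw [this]; fun_prop
    have h4 := (hc.tendsto z₀.re).eventually h2
    filter_upwards [h4] with x hx
    simpa only [Complex.normSq_mk, ← sq] using hx
  let P : Polynomial ℝ := (Polynomial.X ^ 2 + Polynomial.C (z₀.im ^ 2)) *
    (1 - 3 * (Polynomial.X ^ 2 + Polynomial.C (z₀.im ^ 2)) ^ 8)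
  have hP : P = 0 := by
    refine Polynomial.eq_zero_of_infinite_isRoot P ((infinite_of_mem_nhds _ h3).mono ?_)
    intro x hx
    simpa [P, Polynomial.IsRoot] using hx
  have h4 := congrArg (Polynomial.eval 1) hP
  simp only [P, Polynomial.eval_mul, Polynomial.eval_add, Polynomial.eval_sub, Polynomial.eval_pow,
    Polynomial.eval_X, Polynomial.eval_C, Polynomial.eval_one, Polynomial.eval_ofNat, one_pow,
    Polynomial.eval_zero] at h4
  have h5 : (1 : ℝ) ≤ 1 + z₀.im ^ 2 := by nlinarith [sq_nonneg z₀.im]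
  have h6 := one_le_pow₀ (n := 8) h5
  rcases mul_eq_zero.1 h4 with h | h <;> linarith

lemma isHolomorphicallyNondegenerate_exampleM : IsHolomorphicallyNondegenerate exampleM := by
  intro p hp U hU hpU Y hY hT
  have h0 : ∀ q ∈ exampleM ∩ U, Y q = 0 := by
    rintro q ⟨hq, hqU⟩
    obtain ⟨h1, h2⟩ := eq_of_mem_complexTangentSpace (hT q ⟨hq, hqU⟩)
    suffices h : (Y q).1 = 0 by
      ext
      · exact h
      · simp [h1, h]
      · exact h2
    by_contra hne
    set s := q.2.1.re
    have hg : Continuous fun x : ℂ × ℝ => graphPoint x.1 s x.2 := by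
      have := Complex.continuous_conj
      unfold graphPoint defPoly; fun_prop
    have hW : IsOpen {x : ℂ × ℝ | graphPoint x.1 s x.2 ∈ U ∧ (Y (graphPoint x.1 s x.2)).1 ≠ 0} := by
      have hc : ContinuousOn (fun x : ℂ × ℝ => (Y (graphPoint x.1 s x.2)).1)
          {x | graphPoint x.1 s x.2 ∈ U} :=
        continuous_fst.comp_continuousOn (hY.continuousOn.comp hg.continuousOn fun x hx => hx)
      exact hc.isOpen_inter_preimage (hU.preimage hg) isOpen_compl_singleton
    obtain ⟨x, ⟨hx, hx'⟩, hl⟩ := exists_leviPoly_ne_zero hW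
      ⟨(q.1, q.2.2.re), by simp only [mem_ofPred_eq]; rw [← eq_graphPoint hq]; exact ⟨hqU, hne⟩⟩ s
    exact (mul_ne_zero hx' hl) (fst_mul_leviPoly_eq_zero hU hY hT hx)
  filter_upwards [inter_mem_nhdsWithin exampleM (hU.mem_nhds hpU)] with q hq using h0 q hq

/-! ### Identity theorems, polarization and expansions -/

lemma eq_zero_on_ball_of_eventually {k : ℂ → ℂ} {R : ℝ} (hR : 0 < R)
    (hk : DifferentiableOn ℂ k (Metric.ball 0 R)) (h : ∀ᶠ z in 𝓝 0, k z = 0) :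
    ∀ w ∈ Metric.ball (0 : ℂ) R, k w = 0 :=
  (hk.analyticOnNhd Metric.isOpen_ball).eqOn_zero_of_preconnected_of_eventuallyEq_zero
    (convex_ball 0 R).isPreconnected (Metric.mem_ball_self hR) h

lemma eq_zero_on_ball_of_real {k : ℂ → ℂ} {R : ℝ} (hk : DifferentiableOn ℂ k (Metric.ball 0 R))
    (h : ∀ x : ℝ, |x| < R → k x = 0) : ∀ w ∈ Metric.ball (0 : ℂ) R, k w = 0 := by
  intro w hw
  have hR : 0 < R := Metric.pos_of_mem_ball hw
  refine (hk.analyticOnNhd Metric.isOpen_ball).eqOn_zero_of_preconnected_of_frequently_eq_zero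
    (convex_ball 0 R).isPreconnected (Metric.mem_ball_self hR) ?_ hw
  have h1 : Tendsto (fun x : ℝ => (x : ℂ)) (𝓝[≠] 0) (𝓝[≠] 0) := by
    refine tendsto_nhdsWithin_iff.2
      ⟨(Complex.continuous_ofReal.tendsto' 0 0 (by simp)).mono_left nhdsWithin_le_nhds, ?_⟩
    filter_upwards [self_mem_nhdsWithin] with x hx
    simpa using hx
  refine h1.frequently (Eventually.frequently ?_)
  have h2 : ∀ᶠ x : ℝ in 𝓝 0, |x| < R := by
    filter_upwards [Metric.ball_mem_nhds (0 : ℝ) hR] with x hx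
    simpa using hx
  exact (h2.mono h).filter_mono nhdsWithin_le_nhds

lemma mk_mem_ball_zero {z w : ℂ} {R : ℝ} :
    ((z, w) : ℂ × ℂ) ∈ Metric.ball (0 : ℂ × ℂ) R ↔ ‖z‖ < R ∧ ‖w‖ < R := by
  simp [Prod.norm_def]

/-- A function of two variables that vanishes for real second and small first variable is zero. -/
lemma eq_zero_on_ball_of_real_snd {G : ℂ × ℂ → ℂ} {R : ℝ}
    (hG : DifferentiableOn ℂ G (Metric.ball 0 R))
    (h : ∀ s : ℝ, |s| < R → ∀ᶠ z in 𝓝 0, G (z, s) = 0) :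
    ∀ x ∈ Metric.ball (0 : ℂ × ℂ) R, G x = 0 := by
  rintro ⟨z, w⟩ hx
  obtain ⟨hz, hw⟩ := mk_mem_ball_zero.1 hx
  refine eq_zero_on_ball_of_real (k := fun w => G (z, w)) (R := R) ?_ ?_ w (by simpa using hw)
  · exact hG.comp (by fun_prop) fun w hw => mk_mem_ball_zero.2 ⟨hz, by simpa using hw⟩
  · intro s hs
    refine eq_zero_on_ball_of_eventually (k := fun z => G (z, s)) ((abs_nonneg s).trans_lt hs) ?_
      (h s hs) z (by simpa using hz)
    exact hG.comp (by fun_prop) fun z hz =>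
      mk_mem_ball_zero.2 ⟨by simpa using hz, by simpa using hs⟩

/-- Polarization: a holomorphic function `H (z, ζ)` near the origin that vanishes for `ζ = z̄` is
zero. -/
lemma eventually_eq_zero_of_antidiagonal {H : ℂ × ℂ → ℂ}
    (hd : ∀ᶠ x in 𝓝 0, DifferentiableAt ℂ H x) (h : ∀ᶠ z in 𝓝 0, H (z, conj z) = 0) :
    ∀ᶠ x in 𝓝 0, H x = 0 := by
  obtain ⟨δ₁, hδ₁, h₁⟩ := Metric.eventually_nhds_iff_ball.1 hd
  obtain ⟨δ₂, hδ₂, h₂⟩ := Metric.eventually_nhds_iff_ball.1 h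
  obtain ⟨δ, hδ, hδ1, hδ2⟩ : ∃ δ > 0, δ ≤ δ₁ ∧ δ ≤ δ₂ :=
    ⟨min δ₁ δ₂, lt_min hδ₁ hδ₂, min_le_left _ _, min_le_right _ _⟩
  have hsum {a b : ℂ} (ha : ‖a‖ < δ / 2) (hb : ‖b‖ < δ / 2) :
      ‖a + Complex.I * b‖ < δ ∧ ‖a - Complex.I * b‖ < δ := by
    have hI : ‖Complex.I * b‖ = ‖b‖ := by simp
    constructor
    · linarith [norm_add_le a (Complex.I * b)]
    · linarith [norm_sub_le a (Complex.I * b)]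
  -- in the coordinates `z = a + ib`, `ζ = a - ib` the antidiagonal is the set of real points
  have key : ∀ a b : ℂ, ‖a‖ < δ / 2 → ‖b‖ < δ / 2 →
      H (a + Complex.I * b, a - Complex.I * b) = 0 := by
    intro a b ha hb
    refine eq_zero_on_ball_of_real (R := δ / 2)
      (k := fun b => H (a + Complex.I * b, a - Complex.I * b)) ?_ ?_ b (by simpa using hb)
    · intro b hb
      obtain ⟨h3, h4⟩ := hsum ha (by simpa using hb)
      refine DifferentiableAt.differentiableWithinAt ?_
      refine DifferentiableAt.comp b (h₁ _ (mk_mem_ball_zero.2 ⟨?_, ?_⟩)) (by fun_prop)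
      exacts [h3.trans_le hδ1, h4.trans_le hδ1]
    · intro y hy
      refine eq_zero_on_ball_of_real (R := δ / 2)
        (k := fun a => H (a + Complex.I * y, a - Complex.I * y)) ?_ ?_ a (by simpa using ha)
      · intro a ha
        obtain ⟨h3, h4⟩ := hsum (b := y) (by simpa using ha) (by simpa using hy)
        refine DifferentiableAt.differentiableWithinAt ?_
        refine DifferentiableAt.comp a (h₁ _ (mk_mem_ball_zero.2 ⟨?_, ?_⟩)) (by fun_prop)
        exacts [h3.trans_le hδ1, h4.trans_le hδ1]
      · intro x hx
        obtain ⟨h3, -⟩ := hsum (a := x) (b := y) (by simpa using hx) (by simpa using hy)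
        have := h₂ (x + Complex.I * y) (by simpa using h3.trans_le hδ2)
        simpa [sub_eq_add_neg] using this
  filter_upwards [Metric.ball_mem_nhds (0 : ℂ × ℂ) (half_pos hδ)] with x hx
  obtain ⟨z, ζ⟩ := x
  obtain ⟨hz, hζ⟩ := mk_mem_ball_zero.1 hx
  have := key ((z + ζ) / 2) (-Complex.I * (z - ζ) / 2) ?_ ?_
  · convert this using 2
    refine Prod.ext ?_ ?_
    · linear_combination ((z - ζ) / 2) * Complex.I_sq
    · linear_combination (-(z - ζ) / 2) * Complex.I_sq
  · rw [norm_div, Complex.norm_ofNat]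
    linarith [norm_add_le z ζ]
  · rw [norm_div, norm_mul, norm_neg, Complex.norm_I, Complex.norm_ofNat]
    linarith [norm_sub_le z ζ]

lemma exists_first_order_expansion {f : ℂ → ℂ} {c : ℂ} (hf : DifferentiableAt ℂ f c) :
    ∃ κ : ℂ → ℂ, ContinuousAt κ 0 ∧ κ 0 = deriv f c ∧ ∀ v, f (c + v) = f c + v * κ v := by
  refine ⟨fun v => dslope f c (c + v), ?_, by simp, fun v => ?_⟩
  · have h := continuousAt_dslope_same.2 hf
    exact ContinuousAt.comp (f := fun v => c + v) (by rwa [add_zero]) (by fun_prop)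
  · have := sub_smul_dslope f c (c + v)
    rw [add_sub_cancel_left, smul_eq_mul] at this
    rw [this]; ring

lemma exists_second_order_expansion {f : ℂ → ℂ} {c : ℂ} {S : Set ℂ} (hS : S ∈ 𝓝 c)
    (hf : DifferentiableOn ℂ f S) :
    ∃ κ : ℂ → ℂ, ContinuousAt κ 0 ∧
      ∀ v, f (c + v) = f c + v * deriv f c + v ^ 2 * κ v := by
  have h := ((Complex.differentiableOn_dslope hS).2 hf).differentiableAt hS
  obtain ⟨κ, h1, -, h3⟩ := exists_first_order_expansion h
  refine ⟨κ, h1, fun v => ?_⟩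
  have h2 := sub_smul_dslope f c (c + v)
  rw [add_sub_cancel_left, smul_eq_mul, h3, dslope_same] at h2
  linear_combination -h2

/-- Reading off a lowest coefficient: used after the vanishing power of the variable has been
cancelled away from `0`. -/
lemma apply_zero_eq_zero_of_eventually {T : ℂ → ℂ} (hT : ContinuousAt T 0)
    (h : ∀ᶠ ζ in 𝓝[≠] 0, T ζ = 0) : T 0 = 0 :=
  tendsto_nhds_unique (hT.tendsto.mono_left nhdsWithin_le_nhds)
    (tendsto_const_nhds.congr' (h.mono fun _ hζ => hζ.symm))

/-- The function `x ↦ conj (f (conj x))`, which is holomorphic with `f`. -/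
def conjExt (f : ℂ × ℂ → ℂ) (x : ℂ × ℂ) : ℂ := conj (f (conj x.1, conj x.2))

lemma DifferentiableAt.conjExt {f : ℂ × ℂ → ℂ} {x : ℂ × ℂ}
    (hf : DifferentiableAt ℂ f (conj x.1, conj x.2)) : DifferentiableAt ℂ (conjExt f) x := by
  have h := hf.star_star
  have e : star ((conj x.1, conj x.2) : ℂ × ℂ) = x := by ext <;> simp
  rw [e] at h
  exact h

/-! ### The polarized tangency equation -/

/-- For a fixed real value `t` of `w₂`, the components `(f, g, k)` of a holomorphic vector field in
the variables `(z, w₁)` near the origin whose real part is tangent to `exampleM` along the leaf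
`Re w₂ = t`: the differentiated equations of `exampleM` hold at the points of the leaf. -/
structure IsTangentTriple (f g k : ℂ × ℂ → ℂ) (R t : ℝ) : Prop where
  diff_f : DifferentiableOn ℂ f (Metric.ball 0 R)
  diff_g : DifferentiableOn ℂ g (Metric.ball 0 R)
  diff_k : DifferentiableOn ℂ k (Metric.ball 0 R)
  im_k : ∀ (z : ℂ) (s : ℝ), (z, s + Complex.I * defPoly z (conj z) s t) ∈
      Metric.ball (0 : ℂ × ℂ) R →
    (k (z, s + Complex.I * defPoly z (conj z) s t)).im = 0
  im_g : ∀ (z : ℂ) (s : ℝ), (z, s + Complex.I * defPoly z (conj z) s t) ∈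
      Metric.ball (0 : ℂ × ℂ) R →
    ((g (z, s + Complex.I * defPoly z (conj z) s t)).im : ℂ) =
      defPolyDz z (conj z) s t * f (z, s + Complex.I * defPoly z (conj z) s t)
      + defPolyDz (conj z) z s t * conj (f (z, s + Complex.I * defPoly z (conj z) s t))
      + z ^ 4 * conj z ^ 4 * (g (z, s + Complex.I * defPoly z (conj z) s t)).re
      + z ^ 2 * conj z ^ 2 * (k (z, s + Complex.I * defPoly z (conj z) s t)).re

/-- The parametrization of the leaf `w₂ = t` near `w₁ = s`, with `z̄` replaced by an independent
variable `ζ`; here `x = (z, ζ)`. -/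
def polGraph (s t : ℝ) (x : ℂ × ℂ) : ℂ × ℂ := (x.1, s + Complex.I * defPoly x.1 x.2 s t)

/-- The conjugate of `polGraph`, polarized: on the antidiagonal `ζ = z̄` it is the conjugate of
`polGraph`. -/
def polGraphConj (s t : ℝ) (x : ℂ × ℂ) : ℂ × ℂ := (x.2, s - Complex.I * defPoly x.1 x.2 s t)

lemma differentiable_polGraph (s t : ℝ) : Differentiable ℂ (polGraph s t) := by
  unfold polGraph defPoly; fun_prop

lemma differentiable_polGraphConj (s t : ℝ) : Differentiable ℂ (polGraphConj s t) := by
  unfold polGraphConj defPoly; fun_prop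

lemma eventually_polGraph_mem {s R : ℝ} (t : ℝ) (hs : |s| < R) : ∀ᶠ x in 𝓝 (0 : ℂ × ℂ),
    polGraph s t x ∈ Metric.ball (0 : ℂ × ℂ) R ∧
      polGraphConj s t x ∈ Metric.ball (0 : ℂ × ℂ) R := by
  have hR : 0 < R := (abs_nonneg s).trans_lt hs
  refine ((differentiable_polGraph s t).continuous.continuousAt.eventually_mem ?_).and
    ((differentiable_polGraphConj s t).continuous.continuousAt.eventually_mem ?_) <;>
  refine Metric.isOpen_ball.mem_nhds (mk_mem_ball_zero.2 ⟨?_, ?_⟩) <;>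
  simp [defPoly, hR, hs]

lemma DifferentiableOn.conjExt {f : ℂ × ℂ → ℂ} {R : ℝ}
    (hf : DifferentiableOn ℂ f (Metric.ball 0 R)) :
    DifferentiableOn ℂ (conjExt f) (Metric.ball 0 R) := by
  rintro ⟨z, w⟩ hx
  refine DifferentiableAt.differentiableWithinAt (DifferentiableAt.conjExt ?_)
  refine hf.differentiableAt (Metric.isOpen_ball.mem_nhds (mk_mem_ball_zero.2 ?_))
  simpa using mk_mem_ball_zero.1 hx

lemma polGraphConj_antidiagonal (s t : ℝ) (z : ℂ) : polGraphConj s t (z, conj z) =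
    (conj (polGraph s t (z, conj z)).1, conj (polGraph s t (z, conj z)).2) := by
  simp [polGraph, polGraphConj, conj_defPoly, sub_eq_add_neg]

lemma conjExt_polGraphConj (f : ℂ × ℂ → ℂ) (s t : ℝ) (z : ℂ) :
    conjExt f (polGraphConj s t (z, conj z)) = conj (f (polGraph s t (z, conj z))) := by
  simp [conjExt, polGraphConj_antidiagonal]

lemma eventually_differentiableAt_comp {f : ℂ × ℂ → ℂ} {u : ℂ × ℂ → ℂ × ℂ} {R : ℝ}
    (hf : DifferentiableOn ℂ f (Metric.ball 0 R)) (hu : Differentiable ℂ u)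
    (h : ∀ᶠ x in 𝓝 (0 : ℂ × ℂ), u x ∈ Metric.ball (0 : ℂ × ℂ) R) :
    ∀ᶠ x in 𝓝 (0 : ℂ × ℂ), DifferentiableAt ℂ (fun x => f (u x)) x :=
  h.mono fun x hx => (hf.differentiableAt (Metric.isOpen_ball.mem_nhds hx)).comp x (hu x)

namespace IsTangentTriple

variable {f g k : ℂ × ℂ → ℂ} {R t : ℝ}

lemma polarized_k (h : IsTangentTriple f g k R t) {s : ℝ} (hs : |s| < R) :
    ∀ᶠ x in 𝓝 (0 : ℂ × ℂ), k (polGraph s t x) = conjExt k (polGraphConj s t x) := by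
  have hm := eventually_polGraph_mem t hs
  have d1 := eventually_differentiableAt_comp h.diff_k (differentiable_polGraph s t)
    (hm.mono fun _ h => h.1)
  have d2 := eventually_differentiableAt_comp h.diff_k.conjExt (differentiable_polGraphConj s t)
    (hm.mono fun _ h => h.2)
  refine (eventually_eq_zero_of_antidiagonal
    (H := fun x => k (polGraph s t x) - conjExt k (polGraphConj s t x)) ?_ ?_).mono
    fun x hx => sub_eq_zero.1 hx
  · filter_upwards [d1, d2] with x h1 h2 using h1.sub h2
  · have hc : Tendsto (fun z : ℂ => (z, conj z)) (𝓝 0) (𝓝 0) :=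
      (continuous_id.prodMk Complex.continuous_conj).tendsto' 0 0 (by simp)
    filter_upwards [hc.eventually hm] with z hz
    rw [conjExt_polGraphConj, sub_eq_zero]
    exact (Complex.conj_eq_iff_im.2 (h.im_k z s hz.1)).symm

lemma polarized_g (h : IsTangentTriple f g k R t) {s : ℝ} (hs : |s| < R) :
    ∀ᶠ x in 𝓝 (0 : ℂ × ℂ),
      g (polGraph s t x) * (1 - Complex.I * (x.1 ^ 4 * x.2 ^ 4))
        - conjExt g (polGraphConj s t x) * (1 + Complex.I * (x.1 ^ 4 * x.2 ^ 4)) =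
      2 * Complex.I * (defPolyDz x.1 x.2 s t * f (polGraph s t x)
        + defPolyDz x.2 x.1 s t * conjExt f (polGraphConj s t x))
      + Complex.I * (x.1 ^ 2 * x.2 ^ 2)
        * (k (polGraph s t x) + conjExt k (polGraphConj s t x)) := by
  have hm := eventually_polGraph_mem t hs
  have d {f : ℂ × ℂ → ℂ} (hf : DifferentiableOn ℂ f (Metric.ball 0 R)) :=
    (eventually_differentiableAt_comp hf (differentiable_polGraph s t) (hm.mono fun _ h => h.1)).and
    (eventually_differentiableAt_comp hf.conjExt (differentiable_polGraphConj s t)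
    (hm.mono fun _ h => h.2))
  refine (eventually_eq_zero_of_antidiagonal
    (H := fun x => g (polGraph s t x) * (1 - Complex.I * (x.1 ^ 4 * x.2 ^ 4))
        - conjExt g (polGraphConj s t x) * (1 + Complex.I * (x.1 ^ 4 * x.2 ^ 4)) -
      (2 * Complex.I * (defPolyDz x.1 x.2 s t * f (polGraph s t x)
        + defPolyDz x.2 x.1 s t * conjExt f (polGraphConj s t x))
      + Complex.I * (x.1 ^ 2 * x.2 ^ 2)
        * (k (polGraph s t x) + conjExt k (polGraphConj s t x)))) ?_ ?_).mono
    fun x hx => sub_eq_zero.1 hx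
  · filter_upwards [d h.diff_f, d h.diff_g, d h.diff_k] with x ⟨h1, h2⟩ ⟨h3, h4⟩ ⟨h5, h6⟩
    have aux {a b a' b' c c' : ℂ × ℂ → ℂ} (ha : DifferentiableAt ℂ a x)
        (hb : DifferentiableAt ℂ b x) (ha' : DifferentiableAt ℂ a' x)
        (hb' : DifferentiableAt ℂ b' x) (hc : DifferentiableAt ℂ c x)
        (hc' : DifferentiableAt ℂ c' x) :
        DifferentiableAt ℂ (fun x : ℂ × ℂ => a x * (1 - Complex.I * (x.1 ^ 4 * x.2 ^ 4))
          - a' x * (1 + Complex.I * (x.1 ^ 4 * x.2 ^ 4))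
          - (2 * Complex.I * (defPolyDz x.1 x.2 s t * b x + defPolyDz x.2 x.1 s t * b' x)
            + Complex.I * (x.1 ^ 2 * x.2 ^ 2) * (c x + c' x))) x := by
      unfold defPolyDz
      fun_prop
    exact aux h3 h1 h4 h2 h5 h6
  · have hc : Tendsto (fun z : ℂ => (z, conj z)) (𝓝 0) (𝓝 0) :=
      (continuous_id.prodMk Complex.continuous_conj).tendsto' 0 0 (by simp)
    filter_upwards [hc.eventually hm] with z hz
    have e := h.im_g z s hz.1
    have e' : (z, s + Complex.I * defPoly z (conj z) s t) = polGraph s t (z, conj z) := rfl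
    simp only [conjExt_polGraphConj]
    simp only [e'] at e ⊢
    rw [Complex.re_eq_add_conj, Complex.re_eq_add_conj, Complex.im_eq_sub_conj,
      div_eq_iff (by simp)] at e
    linear_combination e

/-- Setting `ζ = 0` in the polarized equations, where `defPoly` and its first derivatives vanish,
shows that `k` and `g` are independent of `z` and real for real `w₁`. -/
lemma eq_fst_zero (h : IsTangentTriple f g k R t) :
    (∀ x ∈ Metric.ball (0 : ℂ × ℂ) R, k x = k (0, x.2)) ∧
    (∀ x ∈ Metric.ball (0 : ℂ × ℂ) R, g x = g (0, x.2)) ∧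
    ∀ s : ℝ, |s| < R → conj (k (0, s)) = k (0, s) ∧ conj (g (0, s)) = g (0, s) := by
  have hc : Tendsto (fun z : ℂ => (z, (0 : ℂ))) (𝓝 0) (𝓝 0) :=
    (by fun_prop : Continuous fun z : ℂ => (z, (0 : ℂ))).tendsto' 0 0 (by simp)
  have hk : ∀ s : ℝ, |s| < R → ∀ᶠ z in 𝓝 0, k (z, s) = conj (k (0, s)) := by
    intro s hs
    filter_upwards [hc.eventually (h.polarized_k hs)] with z hz
    simpa [polGraph, polGraphConj, defPoly, conjExt] using hz
  have hg : ∀ s : ℝ, |s| < R → ∀ᶠ z in 𝓝 0, g (z, s) = conj (g (0, s)) := by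
    intro s hs
    filter_upwards [hc.eventually (h.polarized_g hs)] with z hz
    simpa [polGraph, polGraphConj, defPoly, defPolyDz, conjExt, sub_eq_zero] using hz
  have aux {p : ℂ × ℂ → ℂ} (hd : DifferentiableOn ℂ p (Metric.ball 0 R))
      (hp : ∀ s : ℝ, |s| < R → ∀ᶠ z in 𝓝 0, p (z, s) = conj (p (0, s))) :
      ∀ x ∈ Metric.ball (0 : ℂ × ℂ) R, p x = p (0, x.2) := by
    intro x hx
    refine sub_eq_zero.1 (eq_zero_on_ball_of_real_snd (G := fun x => p x - p (0, x.2)) ?_ ?_ x hx)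
    · refine hd.sub (hd.comp (by fun_prop) ?_)
      rintro ⟨z, w⟩ hx
      obtain ⟨h1, h2⟩ := mk_mem_ball_zero.1 hx
      exact mk_mem_ball_zero.2 ⟨by simpa using (norm_nonneg z).trans_lt h1, h2⟩
    · intro s hs
      filter_upwards [hp s hs] with z hz
      rw [hz, sub_eq_zero]
      exact (hp s hs).self_of_nhds.symm
  exact ⟨aux h.diff_k hk, aux h.diff_g hg, fun s hs =>
    ⟨(hk s hs).self_of_nhds.symm, (hg s hs).self_of_nhds.symm⟩⟩

end IsTangentTriple

/-! ### Coefficients of the tangency equation -/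

lemma eventually_eventually_of_prod {P : ℂ × ℂ → Prop} (h : ∀ᶠ x in 𝓝 (0 : ℂ × ℂ), P x) :
    ∀ᶠ z in 𝓝[≠] (0 : ℂ), z ≠ 0 ∧ ∀ᶠ ζ in 𝓝[≠] (0 : ℂ), ζ ≠ 0 ∧ P (z, ζ) := by
  have h' : ∀ᶠ x in 𝓝 ((0 : ℂ), (0 : ℂ)), P x := h
  rw [nhds_prod_eq] at h'
  refine eventually_mem_nhdsWithin.and ((h'.curry.filter_mono nhdsWithin_le_nhds).mono ?_)
  exact fun z hz => eventually_mem_nhdsWithin.and (hz.filter_mono nhdsWithin_le_nhds)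

lemma continuousAt_comp_add {f : ℂ → ℂ} {c : ℂ} {q : ℂ → ℂ} (hf : ContinuousAt f c)
    (hq : Continuous q) (h0 : q 0 = c) : ContinuousAt (fun ζ => f (q ζ)) 0 :=
  ContinuousAt.comp_of_eq hf hq.continuousAt h0

/-- The coefficients of `z² ζ²`, `z¹⁰ ζ⁴` and `z⁴ ζ⁴` of the polarized tangency equation, for a
field `(z F, g, h)`. They are found by expanding in powers of `ζ` for fixed `z ≠ 0`; the coefficients
of `ζ⁴` are then separated by their dependence on `z`. -/
lemma coeff_relations {g F Fb : ℂ → ℂ} {S : Set ℂ} {s t h : ℂ} (hS : S ∈ 𝓝 s)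
    (hg : DifferentiableOn ℂ g S) (hF : DifferentiableAt ℂ F s) (hFb : DifferentiableAt ℂ Fb s)
    (H : ∀ᶠ x in 𝓝 (0 : ℂ × ℂ),
      g (s + Complex.I * defPoly x.1 x.2 s t) * (1 - Complex.I * (x.1 ^ 4 * x.2 ^ 4))
        - g (s - Complex.I * defPoly x.1 x.2 s t) * (1 + Complex.I * (x.1 ^ 4 * x.2 ^ 4)) =
      2 * Complex.I * (x.1 * defPolyDz x.1 x.2 s t * F (s + Complex.I * defPoly x.1 x.2 s t)
        + x.2 * defPolyDz x.2 x.1 s t * Fb (s - Complex.I * defPoly x.1 x.2 s t))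
      + 2 * Complex.I * (x.1 ^ 2 * x.2 ^ 2) * h) :
    t * deriv g s = 2 * t * (F s + Fb s) + h ∧ deriv g s = 10 * F s + 4 * Fb s ∧
    s * deriv g s - g s =
      4 * s * (F s + Fb s) + 2 * Complex.I * t ^ 2 * (deriv F s - deriv Fb s) := by
  obtain ⟨κ, hκ, eκ⟩ := exists_second_order_expansion hS hg
  obtain ⟨F₁, hF₁, F₁0, eF⟩ := exists_first_order_expansion hF
  obtain ⟨Fb₁, hFb₁, Fb₁0, eFb⟩ := exists_first_order_expansion hFb
  have hgc : ContinuousAt g s := (hg.differentiableAt hS).continuousAt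
  have key : ∀ᶠ z in 𝓝[≠] (0 : ℂ), t * deriv g s = 2 * t * (F s + Fb s) + h ∧
      (s * deriv g s - g s -
        (4 * s * (F s + Fb s) + 2 * Complex.I * t ^ 2 * (deriv F s - deriv Fb s))) +
      z ^ 6 * (deriv g s - (10 * F s + 4 * Fb s)) = 0 := by
    filter_upwards [eventually_eventually_of_prod H] with z ⟨hz, hζ⟩
    -- the deforming polynomial is `ζ ^ 2 * p ζ`
    let p : ℂ → ℂ := fun ζ => t * z ^ 2 + ζ ^ 2 * (s * z ^ 4 + z ^ 10 + z ^ 4 * ζ ^ 6)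
    have hp (ζ : ℂ) : defPoly z ζ s t = ζ ^ 2 * p ζ := by simp only [defPoly, p]; ring
    obtain ⟨Kp, eKp, cKp⟩ : ∃ K : ℂ → ℂ, (∀ ζ, K ζ = κ (Complex.I * (ζ ^ 2 * p ζ))) ∧
        ContinuousAt K 0 := ⟨_, fun ζ => rfl, continuousAt_comp_add hκ (by fun_prop) (by simp)⟩
    obtain ⟨Km, eKm, cKm⟩ : ∃ K : ℂ → ℂ, (∀ ζ, K ζ = κ (-(Complex.I * (ζ ^ 2 * p ζ)))) ∧
        ContinuousAt K 0 := ⟨_, fun ζ => rfl, continuousAt_comp_add hκ (by fun_prop) (by simp)⟩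
    obtain ⟨A, eA, cA⟩ : ∃ K : ℂ → ℂ, (∀ ζ, K ζ = F₁ (Complex.I * (ζ ^ 2 * p ζ))) ∧
        ContinuousAt K 0 := ⟨_, fun ζ => rfl, continuousAt_comp_add hF₁ (by fun_prop) (by simp)⟩
    obtain ⟨Ab, eAb, cAb⟩ : ∃ K : ℂ → ℂ, (∀ ζ, K ζ = Fb₁ (-(Complex.I * (ζ ^ 2 * p ζ)))) ∧
        ContinuousAt K 0 := ⟨_, fun ζ => rfl, continuousAt_comp_add hFb₁ (by fun_prop) (by simp)⟩
    obtain ⟨Gp, eGp, cGp⟩ : ∃ K : ℂ → ℂ, (∀ ζ, K ζ = g (s + Complex.I * (ζ ^ 2 * p ζ))) ∧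
        ContinuousAt K 0 := ⟨_, fun ζ => rfl, continuousAt_comp_add hgc (by fun_prop) (by simp)⟩
    obtain ⟨Gm, eGm, cGm⟩ : ∃ K : ℂ → ℂ, (∀ ζ, K ζ = g (s + -(Complex.I * (ζ ^ 2 * p ζ)))) ∧
        ContinuousAt K 0 := ⟨_, fun ζ => rfl, continuousAt_comp_add hgc (by fun_prop) (by simp)⟩
    let b : ℂ → ℂ := fun ζ => 2 * Complex.I * (s * z ^ 4 + z ^ 10 + z ^ 4 * ζ ^ 6) * deriv g s
      - (p ζ) ^ 2 * (Kp ζ - Km ζ) - Complex.I * z ^ 4 * (Gp ζ + Gm ζ)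
      - 2 * Complex.I * ((4 * s * z ^ 4 + 10 * z ^ 10 + 4 * z ^ 4 * ζ ^ 6)
            * (F s + Complex.I * ζ ^ 2 * p ζ * A ζ)
          + 2 * t * z ^ 2 * Complex.I * p ζ * A ζ
          + (4 * s * z ^ 4 + 4 * z ^ 10 + 10 * z ^ 4 * ζ ^ 6)
            * (Fb s - Complex.I * ζ ^ 2 * p ζ * Ab ζ)
          - 2 * t * z ^ 2 * Complex.I * p ζ * Ab ζ)
    have cp : ContinuousAt p 0 := by fun_prop
    have cb : ContinuousAt b 0 := by fun_prop
    have h1 : ∀ᶠ ζ in 𝓝[≠] (0 : ℂ), 2 * Complex.I * z ^ 2 *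
        (t * deriv g s - (2 * t * (F s + Fb s) + h)) + ζ ^ 2 * b ζ = 0 := by
      filter_upwards [hζ] with ζ ⟨hζ0, hζ⟩
      refine (mul_eq_zero.1 (?_ : ζ ^ 2 * _ = 0)).resolve_left (pow_ne_zero 2 hζ0)
      simp only [hp] at hζ
      have e1 := eκ (Complex.I * (ζ ^ 2 * p ζ))
      have e2 := eκ (-(Complex.I * (ζ ^ 2 * p ζ)))
      rw [← eKp, ← eGp] at e1
      rw [← eKm, ← eGm] at e2
      rw [sub_eq_add_neg s, eF, eFb, ← eA, ← eAb, ← eGp, ← eGm] at hζ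
      have e3 : z * defPolyDz z ζ s t =
          ζ ^ 2 * (2 * t * z ^ 2 + ζ ^ 2 * (4 * s * z ^ 4 + 10 * z ^ 10 + 4 * z ^ 4 * ζ ^ 6)) := by
        simp only [defPolyDz]; ring
      have e4 : ζ * defPolyDz ζ z s t =
          ζ ^ 2 * (2 * t * z ^ 2 + ζ ^ 2 * (4 * s * z ^ 4 + 4 * z ^ 10 + 10 * z ^ 4 * ζ ^ 6)) := by
        simp only [defPolyDz]; ring
      have e5 : p ζ = t * z ^ 2 + ζ ^ 2 * (s * z ^ 4 + z ^ 10 + z ^ 4 * ζ ^ 6) := rfl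
      rw [e3, e4] at hζ
      simp only [b]
      have e6 : Gp ζ - Gm ζ = 2 * Complex.I * (ζ ^ 2 * p ζ) * deriv g s
          - (ζ ^ 2 * p ζ) ^ 2 * (Kp ζ - Km ζ) := by
        linear_combination e1 - e2 + (ζ ^ 2 * p ζ) ^ 2 * (Kp ζ - Km ζ) * Complex.I_sq
      linear_combination hζ - e6 - 2 * Complex.I * ζ ^ 2 * deriv g s * e5
    have h2 := apply_zero_eq_zero_of_eventually (by fun_prop) h1
    have h3 : t * deriv g s - (2 * t * (F s + Fb s) + h) = 0 := by simpa [hz] using h2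
    refine ⟨sub_eq_zero.1 h3, ?_⟩
    have h4 : b 0 = 0 := by
      refine apply_zero_eq_zero_of_eventually cb ?_
      filter_upwards [h1, eventually_mem_nhdsWithin] with ζ h5 h6
      rw [h3, mul_zero, zero_add] at h5
      exact (mul_eq_zero.1 h5).resolve_left (pow_ne_zero 2 h6)
    have h6 : 2 * Complex.I * z ^ 4 ≠ 0 := by simp [hz]
    refine (mul_eq_zero.1 (?_ : 2 * Complex.I * z ^ 4 * _ = 0)).resolve_left h6
    rw [← h4]
    simp only [b, eKp, eKm, eGp, eGm, eA, eAb, p, ← F₁0, ← Fb₁0, ne_eq, OfNat.ofNat_ne_zero,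
      not_false_eq_true, zero_pow, zero_mul, mul_zero, neg_zero, add_zero, sub_self, sub_zero]
    ring
  have h1 := key.exists.choose_spec.1
  have h2 := apply_zero_eq_zero_of_eventually (by fun_prop) (key.mono fun _ h => h.2)
  simp only [ne_eq, OfNat.ofNat_ne_zero, not_false_eq_true, zero_pow, zero_mul, add_zero] at h2
  refine ⟨h1, ?_, sub_eq_zero.1 h2⟩
  obtain ⟨z, hz, hz0⟩ := ((key.mono fun _ h => h.2).and eventually_mem_nhdsWithin).exists
  rw [h2, zero_add] at hz
  exact sub_eq_zero.1 ((mul_eq_zero.1 hz).resolve_left (pow_ne_zero 6 hz0))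

/-! ### Vanishing of tangent holomorphic fields on a leaf -/

/-- The reflection principle for a function of the second variable. -/
lemma conjExt_eq_of_real {p : ℂ × ℂ → ℂ} {R : ℝ} (hp : DifferentiableOn ℂ p (Metric.ball 0 R))
    (h1 : ∀ x ∈ Metric.ball (0 : ℂ × ℂ) R, p x = p (0, x.2))
    (h2 : ∀ s : ℝ, |s| < R → conj (p (0, s)) = p (0, s)) :
    ∀ x ∈ Metric.ball (0 : ℂ × ℂ) R, conjExt p x = p (0, x.2) := by
  rintro ⟨z, w⟩ hx
  obtain ⟨hz, hw⟩ := mk_mem_ball_zero.1 hx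
  have hR : 0 < R := (norm_nonneg z).trans_lt hz
  have h3 : conjExt p (z, w) = conjExt p (0, w) := by
    simp only [conjExt, map_zero]
    rw [h1 _ (mk_mem_ball_zero.2 ⟨by simpa using hz, by simpa using hw⟩)]
  rw [h3]
  have hm : MapsTo (fun w : ℂ => ((0 : ℂ), w)) (Metric.ball 0 R) (Metric.ball 0 R) :=
    fun w hw => mk_mem_ball_zero.2 ⟨by simpa using hR, by simpa using hw⟩
  refine sub_eq_zero.1 (eq_zero_on_ball_of_real (R := R)
    (k := fun w => conjExt p (0, w) - p (0, w)) ?_ ?_ w (by simpa using hw))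
  · exact (hp.conjExt.comp (by fun_prop) hm).sub (hp.comp (by fun_prop) hm)
  · intro s hs
    simp [conjExt, h2 s hs]

/-- For `t ≠ 0` the polynomial `defPoly` takes arbitrarily small nonzero values, so that the factor
`defPoly` can be cancelled in the limit. -/
lemma eq_zero_of_reflection {κ : ℂ → ℂ} {s t : ℂ} (ht : t ≠ 0) (hκ : ContinuousAt κ 0)
    (h : ∀ᶠ x in 𝓝 (0 : ℂ × ℂ), defPoly x.1 x.2 s t *
      (κ (Complex.I * defPoly x.1 x.2 s t) + κ (-(Complex.I * defPoly x.1 x.2 s t))) = 0) :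
    κ 0 = 0 := by
  obtain ⟨z, hz, hζ⟩ := (eventually_eventually_of_prod h).exists
  let p : ℂ → ℂ := fun ζ => t * z ^ 2 + ζ ^ 2 * (s * z ^ 4 + z ^ 10 + z ^ 4 * ζ ^ 6)
  have hp (ζ : ℂ) : defPoly z ζ s t = ζ ^ 2 * p ζ := by simp only [defPoly, p]; ring
  have c1 : ContinuousAt (fun ζ => κ (Complex.I * (ζ ^ 2 * p ζ))) 0 :=
    continuousAt_comp_add hκ (by fun_prop) (by simp)
  have c2 : ContinuousAt (fun ζ => κ (-(Complex.I * (ζ ^ 2 * p ζ)))) 0 :=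
    continuousAt_comp_add hκ (by fun_prop) (by simp)
  have cp : ContinuousAt p 0 := by fun_prop
  have h1 := apply_zero_eq_zero_of_eventually (cp.fun_mul (c1.fun_add c2)) <| by
    filter_upwards [hζ] with ζ ⟨h0, h1⟩
    simp only [hp] at h1
    refine (mul_eq_zero.1 (?_ : ζ ^ 2 * _ = 0)).resolve_left (pow_ne_zero 2 h0)
    rw [← mul_assoc]; exact h1
  simpa [p, hz, ht, ← two_mul] using h1

namespace IsTangentTriple

variable {f g k : ℂ × ℂ → ℂ} {R t : ℝ}

/-- The component `k` takes equal values at `s ± i defPoly`, whence its derivative vanishes on the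
real axis. -/
lemma k_eq (h : IsTangentTriple f g k R t) (ht : t ≠ 0) (hR : 0 < R) :
    ∀ x ∈ Metric.ball (0 : ℂ × ℂ) R, k x = k 0 := by
  obtain ⟨h1, -, h2⟩ := h.eq_fst_zero
  have hm : MapsTo (fun w : ℂ => ((0 : ℂ), w)) (Metric.ball 0 R) (Metric.ball 0 R) :=
    fun w hw => mk_mem_ball_zero.2 ⟨by simpa using hR, by simpa using hw⟩
  have hd : DifferentiableOn ℂ (fun w => k (0, w)) (Metric.ball 0 R) :=
    h.diff_k.comp (by fun_prop) hm
  have h3 : ∀ s : ℝ, |s| < R → deriv (fun w => k (0, w)) s = 0 := by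
    intro s hs
    have hs' : (s : ℂ) ∈ Metric.ball (0 : ℂ) R := by simpa using hs
    obtain ⟨κ, hκ, κ0, eκ⟩ := exists_first_order_expansion
      (hd.differentiableAt (Metric.isOpen_ball.mem_nhds hs'))
    rw [← κ0]
    refine eq_zero_of_reflection (s := s) (t := t) (by exact_mod_cast ht) hκ ?_
    filter_upwards [h.polarized_k hs, eventually_polGraph_mem t hs] with x hx ⟨hx1, hx2⟩
    rw [h1 _ hx1, conjExt_eq_of_real h.diff_k h1 (fun s hs => (h2 s hs).1) _ hx2] at hx
    simp only [polGraph, polGraphConj, sub_eq_add_neg (s : ℂ), eκ] at hx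
    have h5 : Complex.I * (defPoly x.1 x.2 s t * (κ (Complex.I * defPoly x.1 x.2 s t)
        + κ (-(Complex.I * defPoly x.1 x.2 s t)))) = 0 := by
      linear_combination hx
    simpa using h5
  have h4 := eq_zero_on_ball_of_real (hd.deriv Metric.isOpen_ball) h3
  rintro ⟨z, w⟩ hx
  obtain ⟨hz, hw⟩ := mk_mem_ball_zero.1 hx
  rw [h1 _ hx]
  exact Metric.isOpen_ball.is_const_of_deriv_eq_zero (convex_ball 0 R).isPreconnected hd
    (fun w hw => h4 w hw) (by simpa using hw) (Metric.mem_ball_self hR)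

/-- The polarized tangency equation after `g` has been found independent of `z` and `k` constant. -/
lemma equation (h : IsTangentTriple f g k R t) (ht : t ≠ 0) {s : ℝ} (hs : |s| < R) :
    ∀ᶠ x in 𝓝 (0 : ℂ × ℂ),
      g (0, s + Complex.I * defPoly x.1 x.2 s t) * (1 - Complex.I * (x.1 ^ 4 * x.2 ^ 4))
        - g (0, s - Complex.I * defPoly x.1 x.2 s t) * (1 + Complex.I * (x.1 ^ 4 * x.2 ^ 4)) =
      2 * Complex.I * (defPolyDz x.1 x.2 s t * f (polGraph s t x)
        + defPolyDz x.2 x.1 s t * conjExt f (polGraphConj s t x))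
      + 2 * Complex.I * (x.1 ^ 2 * x.2 ^ 2) * k 0 := by
  have hR : 0 < R := (abs_nonneg s).trans_lt hs
  obtain ⟨h1, h1', h2⟩ := h.eq_fst_zero
  filter_upwards [h.polarized_g hs, eventually_polGraph_mem t hs] with x hx ⟨hx1, hx2⟩
  have e := h.k_eq ht hR (0, (polGraphConj s t x).2)
    (mk_mem_ball_zero.2 ⟨by simpa using hR, (mk_mem_ball_zero.1 hx2).2⟩)
  rw [h1' _ hx1, conjExt_eq_of_real h.diff_g h1' (fun s hs => (h2 s hs).2) _ hx2,
    h.k_eq ht hR _ hx1, conjExt_eq_of_real h.diff_k h1 (fun s hs => (h2 s hs).1) _ hx2, e] at hx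
  simp only [polGraph, polGraphConj] at hx ⊢
  linear_combination hx

/-- The coefficients of `ζ` and `ζ²` in the equation: the first gives `f (0, s) = 0`, and the second
expresses `f (z, s)` as a multiple of `z`. -/
lemma exists_f_real_eq_mul (h : IsTangentTriple f g k R t) (ht : t ≠ 0) {s : ℝ} (hs : |s| < R) :
    ∃ c, ∀ᶠ z in 𝓝 (0 : ℂ), f (z, s) = z * c := by
  have hR : 0 < R := (abs_nonneg s).trans_lt hs
  have htc : (t : ℂ) ≠ 0 := by exact_mod_cast ht
  have hs' : (s : ℂ) ∈ Metric.ball (0 : ℂ) R := by simpa using hs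
  have hm : MapsTo (fun w : ℂ => ((0 : ℂ), w)) (Metric.ball 0 R) (Metric.ball 0 R) :=
    fun w hw => mk_mem_ball_zero.2 ⟨by simpa using hR, by simpa using hw⟩
  have hd : DifferentiableAt ℂ (fun w => g (0, w)) s :=
    (h.diff_g.comp (by fun_prop) hm).differentiableAt (Metric.isOpen_ball.mem_nhds hs')
  have hfd {z : ℂ} (hz : ‖z‖ < R) : DifferentiableAt ℂ f (z, s) :=
    h.diff_f.differentiableAt (Metric.isOpen_ball.mem_nhds (mk_mem_ball_zero.2
      ⟨hz, by simpa using hs⟩))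
  have hfb : DifferentiableAt ℂ (conjExt f) (0, s) :=
    h.diff_f.conjExt.differentiableAt (Metric.isOpen_ball.mem_nhds (hm hs'))
  obtain ⟨γ, hγ, γ0, eγ⟩ := exists_first_order_expansion hd
  set L := fderiv ℂ (conjExt f) (0, s)
  have key : ∀ᶠ z in 𝓝[≠] (0 : ℂ), conjExt f (0, s) = 0 ∧
      (conjExt f (0, s) = 0 → t * z ^ 2 * deriv (fun w => g (0, w)) s =
        2 * t * z * f (z, s) + 2 * t * z ^ 2 * L (1, 0) + z ^ 2 * k 0) := by
    have hzR : ∀ᶠ z : ℂ in 𝓝[≠] 0, ‖z‖ < R := by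
      refine Eventually.filter_mono nhdsWithin_le_nhds ?_
      filter_upwards [Metric.ball_mem_nhds (0 : ℂ) hR] with z hz
      simpa using hz
    filter_upwards [eventually_eventually_of_prod (h.equation ht hs), hzR] with z ⟨hz, hζ⟩ hzR
    let p : ℂ → ℂ := fun ζ => t * z ^ 2 + ζ ^ 2 * (s * z ^ 4 + z ^ 10 + z ^ 4 * ζ ^ 6)
    have hp (ζ : ℂ) : defPoly z ζ s t = ζ ^ 2 * p ζ := by simp only [defPoly, p]; ring
    have dp : Differentiable ℂ p := by fun_prop
    have cp : ContinuousAt p 0 := by fun_prop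
    obtain ⟨A, eA, cA⟩ : ∃ K : ℂ → ℂ, (∀ ζ, K ζ = γ (Complex.I * (ζ ^ 2 * p ζ))) ∧
        ContinuousAt K 0 := ⟨_, fun ζ => rfl, continuousAt_comp_add hγ (by fun_prop) (by simp)⟩
    obtain ⟨Ab, eAb, cAb⟩ : ∃ K : ℂ → ℂ, (∀ ζ, K ζ = γ (-(Complex.I * (ζ ^ 2 * p ζ)))) ∧
        ContinuousAt K 0 := ⟨_, fun ζ => rfl, continuousAt_comp_add hγ (by fun_prop) (by simp)⟩
    obtain ⟨C, eC, cC⟩ : ∃ K : ℂ → ℂ, (∀ ζ, K ζ = f (z, s + Complex.I * (ζ ^ 2 * p ζ))) ∧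
        ContinuousAt K 0 := ⟨_, fun ζ => rfl, ContinuousAt.comp_of_eq (hfd hzR).continuousAt
          (f := fun ζ => (z, s + Complex.I * (ζ ^ 2 * p ζ))) (by fun_prop) (by simp)⟩
    obtain ⟨B, eB, dB⟩ : ∃ K : ℂ → ℂ,
        (∀ ζ, K ζ = conjExt f (ζ, s + -(Complex.I * (ζ ^ 2 * p ζ)))) ∧
        HasDerivAt K (L (1, 0)) 0 := by
      refine ⟨_, fun ζ => rfl, ?_⟩
      have d1 : HasDerivAt (fun ζ : ℂ => s + -(Complex.I * (ζ ^ 2 * p ζ))) 0 0 := by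
        have := ((((hasDerivAt_id (0 : ℂ)).fun_pow 2).fun_mul
          (dp 0).hasDerivAt).const_mul Complex.I).neg.const_add (s : ℂ)
        simpa using this
      have d2 := (hasDerivAt_id (0 : ℂ)).prodMk d1
      refine HasFDerivAt.comp_hasDerivAt_of_eq (0 : ℂ) hfb.hasFDerivAt d2 (by simp)
    have hB0 : B 0 = conjExt f (0, s) := by simp [eB]
    have e1 (ζ : ℂ) : defPolyDz z ζ s t =
        ζ ^ 2 * (2 * t * z + ζ ^ 2 * (4 * s * z ^ 3 + 10 * z ^ 9 + 4 * z ^ 3 * ζ ^ 6)) := by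
      simp only [defPolyDz]; ring
    have e2 (ζ : ℂ) : defPolyDz ζ z s t =
        ζ * (2 * t * z ^ 2 + ζ ^ 2 * (4 * s * z ^ 4 + 4 * z ^ 10 + 10 * z ^ 4 * ζ ^ 6)) := by
      simp only [defPolyDz]; ring
    -- the equation, with one factor `ζ` cancelled
    have hT : ∀ᶠ ζ in 𝓝[≠] (0 : ℂ), ζ ≠ 0 ∧
        (2 * t * z ^ 2 + ζ ^ 2 * (4 * s * z ^ 4 + 4 * z ^ 10 + 10 * z ^ 4 * ζ ^ 6)) * B ζ =
        ζ * (p ζ * (A ζ + Ab ζ) / 2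
          - z ^ 4 * ζ ^ 2 * (2 * g (0, s) + Complex.I * (ζ ^ 2 * p ζ) * (A ζ - Ab ζ)) / 2
          - (2 * t * z + ζ ^ 2 * (4 * s * z ^ 3 + 10 * z ^ 9 + 4 * z ^ 3 * ζ ^ 6)) * C ζ
          - z ^ 2 * k 0) := by
      filter_upwards [hζ] with ζ ⟨h0, h1⟩
      refine ⟨h0, ?_⟩
      simp only [polGraph, polGraphConj, hp] at h1
      rw [sub_eq_add_neg (s : ℂ), eγ, eγ, e1, e2, ← eA, ← eAb, ← eC, ← eB] at h1
      have h2 : 2 * Complex.I * ζ ≠ 0 := by simp [h0]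
      refine mul_left_cancel₀ h2 ?_
      linear_combination -h1
    refine ⟨?_, fun h0 => ?_⟩
    · have cB := dB.continuousAt
      have := apply_zero_eq_zero_of_eventually (T := fun ζ =>
        (2 * t * z ^ 2 + ζ ^ 2 * (4 * s * z ^ 4 + 4 * z ^ 10 + 10 * z ^ 4 * ζ ^ 6)) * B ζ -
        ζ * (p ζ * (A ζ + Ab ζ) / 2
          - z ^ 4 * ζ ^ 2 * (2 * g (0, s) + Complex.I * (ζ ^ 2 * p ζ) * (A ζ - Ab ζ)) / 2
          - (2 * t * z + ζ ^ 2 * (4 * s * z ^ 3 + 10 * z ^ 9 + 4 * z ^ 3 * ζ ^ 6)) * C ζ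
          - z ^ 2 * k 0)) (by fun_prop) (hT.mono fun ζ h => sub_eq_zero.2 h.2)
      simpa [hB0, hz, htc] using this
    · obtain ⟨ψ, cψ, ψ0, eψ⟩ := exists_first_order_expansion dB.differentiableAt
      rw [dB.deriv] at ψ0
      have := apply_zero_eq_zero_of_eventually (T := fun ζ =>
        (2 * t * z ^ 2 + ζ ^ 2 * (4 * s * z ^ 4 + 4 * z ^ 10 + 10 * z ^ 4 * ζ ^ 6)) * ψ ζ -
        (p ζ * (A ζ + Ab ζ) / 2
          - z ^ 4 * ζ ^ 2 * (2 * g (0, s) + Complex.I * (ζ ^ 2 * p ζ) * (A ζ - Ab ζ)) / 2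
          - (2 * t * z + ζ ^ 2 * (4 * s * z ^ 3 + 10 * z ^ 9 + 4 * z ^ 3 * ζ ^ 6)) * C ζ
          - z ^ 2 * k 0)) (by fun_prop) <| by
        filter_upwards [hT] with ζ ⟨h3, h4⟩
        have h5 := eψ ζ
        rw [zero_add, hB0, h0, zero_add] at h5
        rw [h5] at h4
        refine mul_left_cancel₀ h3 ?_
        linear_combination h4
      simp only [ψ0, eA, eAb, eC, p, ne_eq, OfNat.ofNat_ne_zero, not_false_eq_true, zero_pow,
        zero_mul, mul_zero, neg_zero, add_zero, sub_zero, γ0, zero_div] at this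
      linear_combination -this
  have h0 : f (0, s) = 0 := by
    obtain ⟨z, hz, -⟩ := key.exists
    simpa [conjExt] using hz
  refine ⟨deriv (fun w => g (0, w)) s / 2 - L (1, 0) - k 0 / (2 * t), ?_⟩
  rw [← nhdsNE_sup_pure, eventually_sup]
  refine ⟨?_, by simpa using h0⟩
  filter_upwards [key, eventually_mem_nhdsWithin] with z ⟨h1, h2⟩ hz
  have h3 := h2 h1
  have hz : z ≠ 0 := hz
  have h4 : 2 * t * z ≠ 0 := by simp [htc, hz]
  refine mul_left_cancel₀ h4 ?_
  have h5 : k 0 / (2 * t) * (2 * t) = k 0 := div_mul_cancel₀ _ (by simp [htc])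
  linear_combination -h3 + z ^ 2 * h5

/-- The factorization `f = z F (w₁)`. The factor is recovered from the values of `f` at a fixed
`z₀ ≠ 0`, which makes its holomorphy evident. -/
lemma exists_f_eq (h : IsTangentTriple f g k R t) (ht : t ≠ 0) (hR : 0 < R) :
    ∃ F : ℂ → ℂ, DifferentiableOn ℂ F (Metric.ball 0 R) ∧
      ∀ x ∈ Metric.ball (0 : ℂ × ℂ) R, f x = x.1 * F x.2 := by
  have hz : ‖((R / 2 : ℝ) : ℂ)‖ < R := by
    rw [Complex.norm_real, Real.norm_eq_abs, abs_of_pos (half_pos hR)]; linarith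
  have hz0 : ((R / 2 : ℝ) : ℂ) ≠ 0 := by exact_mod_cast (half_pos hR).ne'
  set z₀ : ℂ := ((R / 2 : ℝ) : ℂ)
  have hm : MapsTo (fun w : ℂ => (z₀, w)) (Metric.ball 0 R) (Metric.ball 0 R) :=
    fun w hw => mk_mem_ball_zero.2 ⟨hz, by simpa using hw⟩
  have hF : DifferentiableOn ℂ (fun w => f (z₀, w) / z₀) (Metric.ball 0 R) :=
    (h.diff_f.comp (by fun_prop) hm).div_const z₀
  refine ⟨_, hF, fun x hx => sub_eq_zero.1 ?_⟩
  refine eq_zero_on_ball_of_real_snd (G := fun x => f x - x.1 * (f (z₀, x.2) / z₀)) ?_ ?_ x hx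
  · refine h.diff_f.sub (DifferentiableOn.mul (by fun_prop) (hF.comp (by fun_prop) ?_))
    rintro ⟨z, w⟩ hx
    simpa using (mk_mem_ball_zero.1 hx).2
  · intro s hs
    obtain ⟨c, hc⟩ := h.exists_f_real_eq_mul ht hs
    have h1 := eq_zero_on_ball_of_eventually (k := fun z => f (z, s) - z * c) hR ?_
      (hc.mono fun z hz => sub_eq_zero.2 hz) z₀ (by simpa using hz)
    · filter_upwards [hc] with z hz
      rw [hz, sub_eq_zero.1 h1, mul_div_cancel_left₀ _ hz0, sub_self]
    · refine (h.diff_f.comp (by fun_prop) fun z hz => ?_).sub (by fun_prop)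
      exact mk_mem_ball_zero.2 ⟨by simpa using hz, by simpa using hs⟩

/-- The three coefficient relations together say that `F` is real and constant, that
`g' = 14 F` and that `g = 6 s F`, which leaves only zero. -/
lemma eq_zero (h : IsTangentTriple f g k R t) (ht : t ≠ 0) (hR : 0 < R) :
    ∀ x ∈ Metric.ball (0 : ℂ × ℂ) R, f x = 0 ∧ g x = 0 ∧ k x = 0 := by
  obtain ⟨F, hF, hfF⟩ := h.exists_f_eq ht hR
  obtain ⟨h1, h1', h2⟩ := h.eq_fst_zero
  have htc : (t : ℂ) ≠ 0 := by exact_mod_cast ht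
  have hm : MapsTo (fun w : ℂ => ((0 : ℂ), w)) (Metric.ball 0 R) (Metric.ball 0 R) :=
    fun w hw => mk_mem_ball_zero.2 ⟨by simpa using hR, by simpa using hw⟩
  have hg : DifferentiableOn ℂ (fun w => g (0, w)) (Metric.ball 0 R) :=
    h.diff_g.comp (by fun_prop) hm
  have hball {s : ℝ} (hs : |s| < R) : Metric.ball (0 : ℂ) R ∈ 𝓝 (s : ℂ) :=
    Metric.isOpen_ball.mem_nhds (by simpa using hs)
  let Fb : ℂ → ℂ := fun w => conj (F (conj w))
  have hFb : DifferentiableOn ℂ Fb (Metric.ball 0 R) := by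
    intro w hw
    have hw' : conj w ∈ Metric.ball (0 : ℂ) R := by simpa using hw
    have := (hF.differentiableAt (Metric.isOpen_ball.mem_nhds hw')).conj_conj
    rw [Complex.conj_conj] at this
    exact this.differentiableWithinAt
  have rel {s : ℝ} (hs : |s| < R) := coeff_relations (hball hs) hg
    (hF.differentiableAt (hball hs)) (hFb.differentiableAt (hball hs)) (t := t) (h := k 0) <| by
    filter_upwards [h.equation ht hs, eventually_polGraph_mem t hs] with x hx ⟨hx1, hx2⟩
    have hx3 : ((conj x.2, conj (s - Complex.I * defPoly x.1 x.2 s t)) : ℂ × ℂ) ∈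
        Metric.ball (0 : ℂ × ℂ) R := by
      rw [mk_mem_ball_zero, Complex.norm_conj, Complex.norm_conj]
      exact mk_mem_ball_zero.1 hx2
    rw [conjExt, hfF _ hx1] at hx
    simp only [polGraph, polGraphConj] at hx
    rw [hfF _ hx3] at hx
    simp only [map_mul, Complex.conj_conj] at hx
    simp only [Fb]
    linear_combination hx
  have hFbs (s : ℝ) : Fb s = conj (F s) := by simp [Fb]
  have hk0 : conj (k 0) = k 0 := by
    simpa only [Complex.ofReal_zero, Prod.mk_zero_zero] using (h2 0 (by simpa using hR)).1
  -- comparing the second relation with its conjugate shows that `F` is real on the real axis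
  have hreal : ∀ s : ℝ, |s| < R → Fb s = F s := by
    intro s hs
    obtain ⟨r1, r2, -⟩ := rel hs
    have c1 := congrArg conj r1
    have c2 := congrArg conj r2
    simp only [map_mul, map_add, Complex.conj_ofReal, map_ofNat, hFbs, Complex.conj_conj, hk0]
      at c1 c2 r1 r2 ⊢
    have e : (t : ℂ) * (6 * (conj (F s) - F s)) = 0 := by
      linear_combination c1 - r1 + t * r2 - t * c2
    have e2 := (mul_eq_zero.1 e).resolve_left htc
    linear_combination (1 / 6) * e2
  have hFF : ∀ w ∈ Metric.ball (0 : ℂ) R, Fb w - F w = 0 :=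
    eq_zero_on_ball_of_real (hFb.sub hF) fun s hs => sub_eq_zero.2 (hreal s hs)
  have hderiv {s : ℝ} (hs : |s| < R) : deriv Fb s = deriv F s := by
    refine Filter.EventuallyEq.deriv_eq ?_
    filter_upwards [hball hs] with w hw using sub_eq_zero.1 (hFF w hw)
  -- hence `F` is constant and `g` is linear in the second variable
  have hFs {s : ℝ} (hs : |s| < R) : F s = k 0 / (10 * t) := by
    obtain ⟨r1, r2, -⟩ := rel hs
    rw [hreal s hs] at r1 r2
    rw [eq_div_iff (by simp [htc])]
    linear_combination r1 - t * r2
  have hgs : ∀ s : ℝ, |s| < R → g (0, s) - s * (6 * (k 0 / (10 * t))) = 0 := by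
    intro s hs
    obtain ⟨-, r2, r3⟩ := rel hs
    rw [hreal s hs, hFs hs] at r2 r3
    rw [hderiv hs] at r3
    linear_combination s * r2 - r3
  have hgw : ∀ w ∈ Metric.ball (0 : ℂ) R, g (0, w) - w * (6 * (k 0 / (10 * t))) = 0 :=
    eq_zero_on_ball_of_real (hg.sub (by fun_prop)) hgs
  have h0 : |(0 : ℝ)| < R := by simpa using hR
  have hk : k 0 = 0 := by
    have d : deriv (fun w => g (0, w)) ((0 : ℝ) : ℂ) = 6 * (k 0 / (10 * t)) := by
      have e : (fun w => g (0, w)) =ᶠ[𝓝 ((0 : ℝ) : ℂ)] fun w => w * (6 * (k 0 / (10 * t))) := by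
        filter_upwards [hball h0] with w hw using sub_eq_zero.1 (hgw w hw)
      rw [e.deriv_eq]
      simp
    obtain ⟨-, r2, -⟩ := rel h0
    rw [hreal 0 h0, hFs h0, d] at r2
    have e : k 0 / (10 * t) = 0 := by linear_combination (-1 / 8) * r2
    simpa [htc] using e
  have hFw : ∀ w ∈ Metric.ball (0 : ℂ) R, F w = 0 :=
    eq_zero_on_ball_of_real hF fun s hs => by rw [hFs hs, hk, zero_div]
  rintro ⟨z, w⟩ hx
  have hw : w ∈ Metric.ball (0 : ℂ) R := by simpa using (mk_mem_ball_zero.1 hx).2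
  refine ⟨?_, ?_, ?_⟩
  · rw [hfF _ hx, hFw w hw, mul_zero]
  · rw [h1' _ hx, sub_eq_zero.1 (hgw w hw), hk]; simp
  · rw [h.k_eq ht hR _ hx, hk]

end IsTangentTriple

/-! ### Generators of flows and infinitesimal holomorphisms -/

/-- A holomorphic vector field near the origin whose real part is tangent to `exampleM` vanishes on
`exampleM` near the origin. -/
lemma eventually_eq_zero_of_mem_realTangentSpace {U : Set (ℂ × ℂ × ℂ)} (hU : IsOpen U)
    (h0 : 0 ∈ U) {Y : ℂ × ℂ × ℂ → ℂ × ℂ × ℂ} (hY : DifferentiableOn ℂ Y U)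
    (hT : ∀ q ∈ exampleM ∩ U, Y q ∈ realTangentSpace exampleM q) :
    ∀ᶠ q in 𝓝[exampleM] 0, Y q = 0 := by
  obtain ⟨R, hR, hRU⟩ := Metric.isOpen_iff.1 hU 0 h0
  have hmem {z w : ℂ} {t : ℝ} (ht : |t| < R) (h : ((z, w) : ℂ × ℂ) ∈ Metric.ball (0 : ℂ × ℂ) R) :
      ((z, w, (t : ℂ)) : ℂ × ℂ × ℂ) ∈ U := by
    obtain ⟨h1, h2⟩ := mk_mem_ball_zero.1 h
    refine hRU ?_
    simp [Prod.norm_def, h1, h2, ht]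
  have key : ∀ t : ℝ, t ≠ 0 → |t| < R → ∀ z w : ℂ,
      ((z, w) : ℂ × ℂ) ∈ Metric.ball (0 : ℂ × ℂ) R → Y (z, w, t) = 0 := by
    intro t ht htR z w hzw
    have hd : DifferentiableOn ℂ (fun x : ℂ × ℂ => Y (x.1, x.2, t)) (Metric.ball 0 R) :=
      hY.comp (by fun_prop) fun x hx => hmem htR hx
    have tang (z : ℂ) (s : ℝ)
        (h : (z, s + Complex.I * defPoly z (conj z) s t) ∈ Metric.ball (0 : ℂ × ℂ) R) :=
      im_eq_of_mem_realTangentSpace (hT (graphPoint z s t) ⟨graphPoint_mem z s t, hmem htR h⟩)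
    have hI : IsTangentTriple (fun x => (Y (x.1, x.2, t)).1) (fun x => (Y (x.1, x.2, t)).2.1)
        (fun x => (Y (x.1, x.2, t)).2.2) R t :=
      { diff_f := hd.fst
        diff_g := hd.snd.fst
        diff_k := hd.snd.snd
        im_k := fun z s h => (tang z s h).2
        im_g := fun z s h => by
          have := (tang z s h).1
          rw [re_graphPoint] at this
          simpa only [graphPoint, Complex.ofReal_re] using this }
    obtain ⟨h1, h2, h3⟩ := hI.eq_zero ht hR _ hzw
    exact Prod.ext h1 (Prod.ext h2 h3)
  filter_upwards [inter_mem_nhdsWithin exampleM (Metric.ball_mem_nhds 0 hR)] with q ⟨hq, hqR⟩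
  have hq2 := congrArg (fun x : ℂ × ℂ × ℂ => x.2.2) (eq_graphPoint hq)
  obtain ⟨z, w, w'⟩ := q
  obtain ⟨t, rfl⟩ : ∃ t : ℝ, w' = t := ⟨_, hq2⟩
  have hn : ‖z‖ < R ∧ ‖w‖ < R ∧ |t| < R := by simpa [Prod.norm_def] using hqR
  have hzw : ((z, w) : ℂ × ℂ) ∈ Metric.ball (0 : ℂ × ℂ) R := mk_mem_ball_zero.2 ⟨hn.1, hn.2.1⟩
  rcases ne_or_eq t 0 with ht | rfl
  · exact key t ht hn.2.2 z w hzw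
  · -- the slice `Re w₂ = 0` is a limit of the others
    have hc : ContinuousAt (fun t : ℝ => Y (z, w, t)) 0 := by
      have h1 : ContinuousAt Y (z, w, ((0 : ℝ) : ℂ)) :=
        (hY.differentiableAt (hU.mem_nhds (hRU hqR))).continuousAt
      exact ContinuousAt.comp (f := fun t : ℝ => ((z, w, (t : ℂ)) : ℂ × ℂ × ℂ)) h1
        (by fun_prop)
    refine tendsto_nhds_unique (hc.tendsto.mono_left (nhdsWithin_le_nhds (s := {0}ᶜ)))
      (tendsto_const_nhds.congr' ?_)
    have h2 : ∀ᶠ t : ℝ in 𝓝[≠] 0, |t| < R := by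
      refine Eventually.filter_mono nhdsWithin_le_nhds ?_
      filter_upwards [Metric.ball_mem_nhds (0 : ℝ) hR] with x hx
      simpa using hx
    filter_upwards [h2, eventually_mem_nhdsWithin] with t h3 h4
    exact (key t h4 h3 z w hzw).symm

section Flow

variable {E : Type*} [NormedAddCommGroup E] [NormedSpace ℂ E]

/-- The Cauchy-Riemann equations. -/
lemma DifferentiableAt.complex_of_real {Y : E → E} {x : E} (h : DifferentiableAt ℝ Y x)
    (hI : ∀ v, fderiv ℝ Y x (Complex.I • v) = Complex.I • fderiv ℝ Y x v) :
    DifferentiableAt ℂ Y x := by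
  refine (differentiableAt_iff_restrictScalars ℝ h).2
    ⟨{ toFun := fderiv ℝ Y x
       map_add' := map_add _
       map_smul' := fun c v => ?_
       cont := (fderiv ℝ Y x).cont }, rfl⟩
  have h1 (v : E) : c • v = c.re • v + c.im • (Complex.I • v) := by
    conv_lhs => rw [← Complex.re_add_im c, add_smul, mul_smul]
    rfl
  rw [h1 v, map_add, map_smul, map_smul, hI, RingHom.id_apply, h1 (fderiv ℝ Y x v)]

namespace IsLocalBiholomorphismGroup

variable {Φ : ℝ → E → E} {U : Set E} {ε : ℝ}

lemma contDiffAt (h : IsLocalBiholomorphismGroup Φ U ε) {t : ℝ} (ht : t ∈ Ioo (-ε) ε) {x : E}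
    (hx : x ∈ U) : ContDiffAt ℝ ∞ (fun x : ℝ × E => Φ x.1 x.2) (t, x) :=
  h.smooth.contDiffAt ((isOpen_Ioo.prod h.isOpen).mem_nhds ⟨ht, hx⟩)

/-- The vector field `∂Φ/∂t` at `t = 0`. -/
def generator (Φ : ℝ → E → E) (x : E) : E := fderiv ℝ (fun x : ℝ × E => Φ x.1 x.2) (0, x) (1, 0)

lemma hasDerivAt_generator (h : IsLocalBiholomorphismGroup Φ U ε) {x : E} (hx : x ∈ U) :
    HasDerivAt (fun t => Φ t x) (generator Φ x) 0 := by
  have h0 : (0 : ℝ) ∈ Ioo (-ε) ε := ⟨neg_lt_zero.2 h.pos, h.pos⟩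
  have h1 := ((h.contDiffAt h0 hx).differentiableAt (by simp)).hasFDerivAt
  exact h1.comp_hasDerivAt (0 : ℝ) ((hasDerivAt_id (0 : ℝ)).prodMk (hasDerivAt_const (0 : ℝ) x))

lemma differentiableOn_generator (h : IsLocalBiholomorphismGroup Φ U ε) :
    DifferentiableOn ℂ (generator Φ) U := by
  intro x hx
  refine DifferentiableAt.differentiableWithinAt ?_
  have h0 : (0 : ℝ) ∈ Ioo (-ε) ε := ⟨neg_lt_zero.2 h.pos, h.pos⟩
  set Ψ : ℝ × E → E := fun x => Φ x.1 x.2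
  have hc := h.contDiffAt h0 hx
  have two_le_infty : (2 : WithTop ℕ∞) ≤ ∞ := WithTop.coe_le_coe.2 (le_top (a := (2 : ℕ∞)))
  have hd : DifferentiableAt ℝ (fderiv ℝ Ψ) (0, x) :=
    (hc.fderiv_right (m := 1) two_le_infty).differentiableAt (by simp)
  set D := fderiv ℝ (fderiv ℝ Ψ) (0, x)
  have hsymm : ∀ v w, D v w = D w v := hc.isSymmSndFDerivAt (by
    rw [minSmoothness_of_isRCLikeNormedField]; exact two_le_infty)
  have h1 : HasFDerivAt (generator Φ)
      ((ContinuousLinearMap.apply ℝ E ((1, 0) : ℝ × E)).comp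
        (D.comp (ContinuousLinearMap.inr ℝ ℝ E))) x := by
    have h2 : HasFDerivAt (fun y : E => ((0 : ℝ), y)) (ContinuousLinearMap.inr ℝ ℝ E) x :=
      hasFDerivAt_prodMk_right 0 x
    exact (ContinuousLinearMap.apply ℝ E ((1, 0) : ℝ × E)).hasFDerivAt.comp x
      (hd.hasFDerivAt.comp x h2)
  -- the mixed second derivative is the `t`-derivative of the complex linear maps `D(Φ t)(x)`
  have h2 (v : E) : HasDerivAt (fun t : ℝ => fderiv ℝ Ψ (t, x) (0, v)) (D (1, 0) (0, v)) 0 := by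
    have h3 : HasDerivAt (fun t : ℝ => (t, x)) ((1, 0) : ℝ × E) 0 :=
      (hasDerivAt_id (0 : ℝ)).prodMk (hasDerivAt_const (0 : ℝ) x)
    have h4 := hd.hasFDerivAt.comp_hasDerivAt (0 : ℝ) h3
    exact (ContinuousLinearMap.apply ℝ E ((0, v) : ℝ × E)).hasFDerivAt.comp_hasDerivAt (0 : ℝ) h4
  have h3 (v : E) : ∀ t ∈ Ioo (-ε) ε,
      fderiv ℝ Ψ (t, x) (0, Complex.I • v) = Complex.I • fderiv ℝ Ψ (t, x) (0, v) := by
    intro t ht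
    have h4 := (((h.contDiffAt ht hx).differentiableAt (by simp)).hasFDerivAt).comp x
      (hasFDerivAt_prodMk_right t x)
    have h5 := (((h.biholomorphic t ht).1.differentiableAt
      (h.isOpen.mem_nhds hx)).hasFDerivAt).restrictScalars ℝ
    have h6 := h4.unique h5
    have h7 (v : E) : fderiv ℝ Ψ (t, x) (0, v) = fderiv ℂ (Φ t) x v := by
      simpa using congrArg (fun L : E →L[ℝ] E => L v) h6
    rw [h7, h7, map_smul]
  refine DifferentiableAt.complex_of_real h1.differentiableAt fun v => ?_
  rw [h1.fderiv]
  simp only [ContinuousLinearMap.comp_apply, ContinuousLinearMap.apply_apply,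
    ContinuousLinearMap.inr_apply]
  rw [hsymm, hsymm (0, v)]
  refine (h2 _).unique (((h2 v).const_smul Complex.I).congr_of_eventuallyEq ?_)
  filter_upwards [isOpen_Ioo.mem_nhds h0] with t ht using h3 v t ht

end IsLocalBiholomorphismGroup

end Flow

lemma germ_eq_zero_of_isInfinitesimalHolomorphism {X : ℂ × ℂ × ℂ → ℂ × ℂ × ℂ}
    (hX : IsInfinitesimalHolomorphism exampleM 0 X) : ∀ᶠ q in 𝓝[exampleM] 0, X q = 0 := by
  obtain ⟨V, -, -, ⟨-, hXT⟩, Φ, U, ε, hΦ, h0, hflow⟩ := hX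
  have ht0 : (0 : ℝ) ∈ Ioo (-ε) ε := ⟨neg_lt_zero.2 hΦ.pos, hΦ.pos⟩
  have hXY : ∀ q ∈ exampleM ∩ U,
      X q = IsLocalBiholomorphismGroup.generator Φ q ∧ X q ∈ realTangentSpace exampleM q := by
    intro q hq
    obtain ⟨h1, h2⟩ := hflow q hq 0 ht0
    rw [hΦ.map_zero q hq.2] at h1 h2
    exact ⟨h2.unique (hΦ.hasDerivAt_generator hq.2), hXT q h1⟩
  have h1 := eventually_eq_zero_of_mem_realTangentSpace hΦ.isOpen h0 hΦ.differentiableOn_generator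
    fun q hq => (hXY q hq).1 ▸ (hXY q hq).2
  filter_upwards [h1, inter_mem_nhdsWithin exampleM (hΦ.isOpen.mem_nhds h0)] with q h2 h3
  rw [(hXY q h3).1, h2]

lemma hol_exampleM : hol exampleM 0 = ⊥ := by
  refine le_bot_iff.1 (sInf_le ⟨fun X hX => ?_, fun X Y V _ _ _ _ hX hY => ?_⟩)
  · exact (Submodule.mem_bot ℝ).2
      (Filter.Germ.coe_eq.2 (germ_eq_zero_of_isInfinitesimalHolomorphism hX))
  · have hX' : ∀ᶠ q in 𝓝[exampleM] 0, X q = 0 := Filter.Germ.coe_eq.1 ((Submodule.mem_bot ℝ).1 hX)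
    have hY' : ∀ᶠ q in 𝓝[exampleM] 0, Y q = 0 := Filter.Germ.coe_eq.1 ((Submodule.mem_bot ℝ).1 hY)
    refine (Submodule.mem_bot ℝ).2 (Filter.Germ.coe_eq.2 ?_)
    filter_upwards [hX', hY'] with q h1 h2
    simp [VectorField.lieBracket, h1, h2]

end

theorem proposition4p2p2 :
    IsCRSubmanifold exampleM 2 1 ∧
    IsHolomorphicallyNondegenerate exampleM ∧
    (∀ p ∈ exampleM, ¬ IsMinimalAt exampleM p) ∧
    hol exampleM 0 = ⊥ :=
  ⟨isCRSubmanifold_exampleM, isHolomorphicallyNondegenerate_exampleM,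
    fun _ hp => not_isMinimalAt_exampleM hp, hol_exampleM⟩
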